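/- Let $\mathbb{R}^2\subset\mathbb{RP}^2$ via $(u,v)\mapsto[u:v:1]$. A finite set $S\subset\mathbb{R}^2$ is in general position if no three of its points are collinear. An affine hole in $S$ is a convex polygon with $k\ge 3$ vertices, all of them points of $S$, whose interior contains no point of $S$. A subset $X\subseteq\mathbb{RP}^2$ is convex if any two points of $X$ can be joined by a projective line segment contained in $X$ and $X$ is disjoint from some projective line; a projective convex hull of $Y\subset\mathbb{RP}^2$ is an inclusion-wise minimal convex set containing $Y$ (it need not be unique). A projective hole in $S$ is a subset $H\subseteq\mathbb{RP}^2$ that is a projective convex hull of some set $I\subseteq S$ of $k\ge 3$ points, has all points of $I$ on its boundary, and has no point of $S$ in its interior. Theorem. There are absolute constants $C,c>0$ such that for all integers $n\ge 3$ and $x\ge 1$ with $x\le 2^{n/2}$ there is a set $S=S(n,x)$ of $n$ points in general position in $\mathbb{R}^2\subset\mathbb{RP}^2$ that has at most $C(x+n^2)$ affine holes in $\mathbb{R}^2$ and at least $c\,x^2$ projective holes (holes of all sizes being counted in both cases). -/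

import Mathlib

open scoped LinearAlgebra.Projectivization

noncomputable section

namespace ProjHoles

/-- The Euclidean plane. -/
abbrev Plane : Type := EuclideanSpace ℝ (Fin 2)

/-- The real projective plane: lines through the origin of `ℝ³`. -/
abbrev RP2 : Type := ℙ ℝ (Fin 3 → ℝ)

/-- The usual topology of the real projective plane: the quotient topology from `ℝ³ \ {0}`. -/
instance instTopologicalSpaceRP2 : TopologicalSpace RP2 :=
  TopologicalSpace.coinduced (Projectivization.mk' ℝ)
    (inferInstance : TopologicalSpace {v : Fin 3 → ℝ // v ≠ 0})

/-- The standard inclusion of the plane into the real projective plane, `(x, y) ↦ [x : y : 1]`. -/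
def embed (p : Plane) : RP2 :=
  Projectivization.mk ℝ ![p 0, p 1, 1] (fun h => one_ne_zero (congrFun h 2))

/-- No three points of `S` lie on a common line. -/
def GeneralPosition (S : Set Plane) : Prop :=
  ∀ p ∈ S, ∀ q ∈ S, ∀ r ∈ S, p ≠ q → p ≠ r → q ≠ r → ¬ Collinear ℝ ({p, q, r} : Set Plane)

/-! ### Affine holes -/

/-- `H` is an affine `k`-hole in `S`: a convex polygon whose vertex set consists of `k` points
of `S` and whose interior contains no point of `S`. -/
def IsAffineKHole (S : Finset Plane) (k : ℕ) (H : Set Plane) : Prop :=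
  ∃ I : Finset Plane, I ⊆ S ∧ I.card = k ∧
    ConvexIndependent ℝ (Subtype.val : {p // p ∈ I} → Plane) ∧
    H = convexHull ℝ (I : Set Plane) ∧ Disjoint (interior H) (S : Set Plane)

/-- The affine holes (of all sizes `k ≥ 3`) in `S`. -/
def affineHoles (S : Finset Plane) : Set (Set Plane) :=
  {H | ∃ k : ℕ, 3 ≤ k ∧ IsAffineKHole S k H}

theorem affineHoles_finite (S : Finset Plane) : (affineHoles S).Finite := by
  refine (S.powerset.finite_toSet.image fun I : Finset Plane => convexHull ℝ (I : Set Plane)).subset ?_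
  rintro H ⟨k, -, I, hI, -, -, rfl, -⟩
  exact ⟨I, Finset.mem_coe.2 (Finset.mem_powerset.2 hI), rfl⟩

/-! ### Projective holes -/

/-- `L` is a projective line: the points `[v]` with `f v = 0`, for a nonzero linear form `f`. -/
def IsProjLine (L : Set RP2) : Prop :=
  ∃ f : (Fin 3 → ℝ) →ₗ[ℝ] ℝ, f ≠ 0 ∧ L = {p | f p.rep = 0}

/-- The projective line segment with endpoints `[u]` and `[v]` swept out by the nonnegative
combinations of `u` and `v`. The two segments joining `[u] ≠ [v]` are `projSegment u v` and
`projSegment u (-v)`. -/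
def projSegment (u v : Fin 3 → ℝ) : Set RP2 :=
  {p | ∃ s t : ℝ, 0 ≤ s ∧ 0 ≤ t ∧ ∃ h : s • u + t • v ≠ 0, p = Projectivization.mk ℝ (s • u + t • v) h}

/-- Any two points of `X` can be joined by a line segment fully contained in `X`. -/
def IsSemiconvex (X : Set RP2) : Prop :=
  ∀ p ∈ X, ∀ q ∈ X, ∃ (u v : Fin 3 → ℝ) (hu : u ≠ 0) (hv : v ≠ 0),
    Projectivization.mk ℝ u hu = p ∧ Projectivization.mk ℝ v hv = q ∧ projSegment u v ⊆ X

/-- `X` is semiconvex and contained in an affine plane, that is, in the complement of some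
projective line. -/
def IsProjConvex (X : Set RP2) : Prop :=
  IsSemiconvex X ∧ ∃ L : Set RP2, IsProjLine L ∧ Disjoint X L

/-- `X` is a projective convex hull of `Y`: an inclusion-wise minimal convex set containing `Y`
(in general not unique). -/
def IsProjConvexHull (Y X : Set RP2) : Prop :=
  Minimal (fun Z : Set RP2 => IsProjConvex Z ∧ Y ⊆ Z) X

/-- `G` is a projective `k`-gon determined by `P`: a projective convex hull of a set of `k` points
of `P` that has all these points on its boundary. -/
def IsProjKGon (P : Set RP2) (k : ℕ) (G : Set RP2) : Prop :=
  ∃ I : Finset RP2, (I : Set RP2) ⊆ P ∧ I.card = k ∧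
    IsProjConvexHull (I : Set RP2) G ∧ (I : Set RP2) ⊆ frontier G

/-- `H` is a projective `k`-hole in `P`: a projective `k`-gon determined by `P` with no point of
`P` in its interior. -/
def IsProjKHole (P : Set RP2) (k : ℕ) (H : Set RP2) : Prop :=
  IsProjKGon P k H ∧ Disjoint (interior H) P

/-- The projective holes (of all sizes `k ≥ 3`) in `P`. -/
def projHoles (P : Set RP2) : Set (Set RP2) :=
  {H | ∃ k : ℕ, 3 ≤ k ∧ IsProjKHole P k H}

end ProjHoles

end

open scoped LinearAlgebra.Projectivization

noncomputable section

namespace ProjHoles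

/-! ### Horton sets -/

/-! The set consists of `k` points on each branch of the hyperbola `xy = 1`, where `k` is the
integer part of `log₂ x`, and of a flat Horton set of the remaining `n - 2k` points between the
branches.

Projectively the hyperbola is a single conic. In the chart where the second coordinate is 1 it
becomes the parabola of the points `(t², t)`, and any set of at least three of its points spans an
inscribed convex polygon inside `xy ≥ 1`. The Horton points satisfy `xy < 1`, so all these polygons
are holes. They are pairwise distinct, which gives about `2 ^ (2k)`, hence order `x²`, projective
holes (`projHull_conic_mem_projHoles`, `two_pow_le_ncard_projHoles`).

In the affine plane each branch bulges towards everything else. An affine hole with a vertex off a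
given branch therefore uses at most two points of that branch, consecutive ones
(`TrianglesEmpty.mem_betweenFamily_false`). Holes inside one branch number at most `2 ^ k ≤ x`. All
others are controlled by the Horton set: it has quadratically many holes, linearly many vertex sets
visible from above or from below, and only consecutive pairs when seen from both sides
(`card_hortonHoles`, `card_hortonCups`, `card_hortonCaps`). The largest mixed term is of order `k²
n`, which is absorbed by `n² + k⁴` and hence by `n² + 2 ^ k`.

The Horton bounds rest on two facts: the points of even index and those of odd index are each an
affine copy of a Horton set, and each class lies far on one side of every line through two points of
the other. -/

/-- The height function of a Horton set: the binary digits of the index, starting with the least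
significant one, are weighted with the powers of `ε`. -/
def hortonHeight (ε : ℝ) : ℕ → ℝ
  | 0 => 0
  | n + 1 => (((n + 1) % 2 : ℕ) : ℝ) + ε * hortonHeight ε ((n + 1) / 2)
decreasing_by omega

theorem hortonHeight_even (ε : ℝ) (t : ℕ) : hortonHeight ε (2 * t) = ε * hortonHeight ε t := by
  rcases t with _ | t
  · simp [hortonHeight]
  · rw [show 2 * (t + 1) = (2 * t + 1) + 1 by ring, hortonHeight,
      show (2 * t + 1 + 1) % 2 = 0 by omega, show (2 * t + 1 + 1) / 2 = t + 1 by omega]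
    simp

theorem hortonHeight_odd (ε : ℝ) (t : ℕ) :
    hortonHeight ε (2 * t + 1) = 1 + ε * hortonHeight ε t := by
  rw [hortonHeight, show (2 * t + 1) % 2 = 1 by omega, show (2 * t + 1) / 2 = t by omega]
  simp

theorem hortonHeight_mem {ε : ℝ} (h0 : 0 ≤ ε) (h1 : ε ≤ 1 / 2) (n : ℕ) :
    0 ≤ hortonHeight ε n ∧ hortonHeight ε n ≤ 2 := by
  induction n using Nat.strong_induction_on with
  | _ n ih =>
    rcases Nat.even_or_odd' n with ⟨t, rfl | rfl⟩
    · rcases Nat.eq_zero_or_pos t with rfl | ht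
      · simp [hortonHeight]
      · obtain ⟨h2, h3⟩ := ih t (by omega)
        rw [hortonHeight_even]
        constructor <;> nlinarith
    · obtain ⟨h2, h3⟩ := ih t (by omega)
      rw [hortonHeight_odd]
      constructor <;> nlinarith

/-- Twice the signed area of the triangle spanned by three points of the graph of
`hortonHeight ε`. -/
def hortonArea (ε : ℝ) (i j k : ℕ) : ℝ :=
  ((j : ℝ) - i) * (hortonHeight ε k - hortonHeight ε i) -
    (hortonHeight ε j - hortonHeight ε i) * ((k : ℝ) - i)

theorem hortonArea_cyclic (ε : ℝ) (i j k : ℕ) : hortonArea ε j k i = hortonArea ε i j k := by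
  unfold hortonArea; ring

theorem hortonArea_swap (ε : ℝ) (i j k : ℕ) : hortonArea ε j i k = -hortonArea ε i j k := by
  unfold hortonArea; ring

/-- Self-similarity: doubling the index is an affine map of the graph, stretching by 2 horizontally
and by `ε` vertically. -/
theorem hortonArea_even (ε : ℝ) (i j k : ℕ) :
    hortonArea ε (2 * i) (2 * j) (2 * k) = 2 * ε * hortonArea ε i j k := by
  simp only [hortonArea, hortonHeight_even]; push_cast; ring

theorem hortonArea_odd (ε : ℝ) (i j k : ℕ) :
    hortonArea ε (2 * i + 1) (2 * j + 1) (2 * k + 1) = 2 * ε * hortonArea ε i j k := by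
  simp only [hortonArea, hortonHeight_odd]; push_cast; ring

/-- The parity digit contributes about `2 * d`. All perturbations carry a factor `ε` and amount to
at most `2 * ε * N` once the first product is bounded below by `2 * (1 - 2 * ε)`; `ε * (N + 4) ≤ 1`
makes this smaller than the main term. -/
theorem deep_bound {ε N d h₁ h₂ h₃ y : ℝ} (h0 : 0 < ε) (hN : 0 ≤ N) (hε : ε * (N + 4) ≤ 1)
    (hd : 1 ≤ d) (h1 : 0 ≤ h₁ ∧ h₁ ≤ 2) (h2 : 0 ≤ h₂ ∧ h₂ ≤ 2) (h3 : 0 ≤ h₃ ∧ h₃ ≤ 2)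
    (hy : |y| ≤ N) :
    0 < 2 * d * (1 + ε * (h₃ - h₁)) - ε * (h₂ - h₁) * y := by
  have hA : -2 ≤ h₃ - h₁ := by linarith [h1.2, h3.1]
  have hB : |h₂ - h₁| ≤ 2 := by rw [abs_le]; constructor <;> linarith [h1.1, h1.2, h2.1, h2.2]
  have hC : (h₂ - h₁) * y ≤ 2 * N :=
    (le_abs_self _).trans (by rw [abs_mul]; gcongr)
  have hD : ε * ((h₂ - h₁) * y) ≤ ε * (2 * N) := by gcongr
  have hE : 1 - 2 * ε ≤ 1 + ε * (h₃ - h₁) := by nlinarith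
  have hF : 0 ≤ 1 - 2 * ε := by nlinarith
  have hG : 2 * (1 - 2 * ε) ≤ 2 * d * (1 + ε * (h₃ - h₁)) := by
    nlinarith
  nlinarith

theorem hortonArea_even_even_odd {ε : ℝ} {N : ℕ} (h0 : 0 < ε) (hε : ε * (N + 4) ≤ 1) {i j k : ℕ}
    (hij : i < j) (hj : 2 * j < N) (hk : 2 * k + 1 < N) :
    0 < hortonArea ε (2 * i) (2 * j) (2 * k + 1) := by
  have hN : (0 : ℝ) ≤ N := N.cast_nonneg
  have hh := hortonHeight_mem h0.le (by nlinarith : ε ≤ 1 / 2)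
  have h1 : (i : ℝ) + 1 ≤ j := by exact_mod_cast hij
  have h2 : (2 : ℝ) * j < N := by exact_mod_cast hj
  have h3 : (2 : ℝ) * k + 1 < N := by exact_mod_cast hk
  have hy : |2 * (k : ℝ) + 1 - 2 * i| ≤ N := by
    have := i.cast_nonneg (α := ℝ)
    have := k.cast_nonneg (α := ℝ)
    rw [abs_le]; constructor <;> linarith
  have := deep_bound (d := (j : ℝ) - i) h0 hN hε (by linarith) (hh i) (hh j) (hh k) hy
  simp only [hortonArea, hortonHeight_even, hortonHeight_odd]
  push_cast
  linarith

theorem hortonArea_odd_odd_even {ε : ℝ} {N : ℕ} (h0 : 0 < ε) (hε : ε * (N + 4) ≤ 1) {i j k : ℕ}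
    (hij : i < j) (hj : 2 * j + 1 < N) (hk : 2 * k < N) :
    hortonArea ε (2 * i + 1) (2 * j + 1) (2 * k) < 0 := by
  have hN : (0 : ℝ) ≤ N := N.cast_nonneg
  have hh := hortonHeight_mem h0.le (by nlinarith : ε ≤ 1 / 2)
  -- Reflecting the heights, `h ↦ 2 - h`, exchanges above and below, so the same estimate applies.
  have hh' : ∀ t, 0 ≤ 2 - hortonHeight ε t ∧ 2 - hortonHeight ε t ≤ 2 := fun t => by
    constructor <;> linarith [(hh t).1, (hh t).2]
  have h1 : (i : ℝ) + 1 ≤ j := by exact_mod_cast hij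
  have h2 : (2 : ℝ) * j + 1 < N := by exact_mod_cast hj
  have h3 : (2 : ℝ) * k < N := by exact_mod_cast hk
  have hy : |2 * (k : ℝ) - (2 * i + 1)| ≤ N := by
    have := i.cast_nonneg (α := ℝ)
    have := k.cast_nonneg (α := ℝ)
    rw [abs_le]; constructor <;> linarith
  have := deep_bound (d := (j : ℝ) - i) h0 hN hε (by linarith) (hh' i) (hh' j) (hh' k) hy
  simp only [hortonArea, hortonHeight_even, hortonHeight_odd]
  push_cast
  linarith

/-- If the parities differ, two indices share one and the third point is strictly off their line; if
all agree, self-similarity reduces to half the indices. -/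
theorem hortonArea_ne_zero {ε : ℝ} {N : ℕ} (h0 : 0 < ε) (hε : ε * (N + 4) ≤ 1) {i j k : ℕ}
    (hij : i < j) (hjk : j < k) (hk : k < N) : hortonArea ε i j k ≠ 0 := by
  induction k using Nat.strong_induction_on generalizing i j with
  | _ k ih =>
    have hc := hortonArea_cyclic ε
    have E := fun {a b c : ℕ} => hortonArea_even_even_odd (i := a) (j := b) (k := c) h0 hε
    have O := fun {a b c : ℕ} => hortonArea_odd_odd_even (i := a) (j := b) (k := c) h0 hε
    rcases Nat.even_or_odd' i with ⟨a, rfl | rfl⟩ <;>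
      rcases Nat.even_or_odd' j with ⟨b, rfl | rfl⟩ <;>
      rcases Nat.even_or_odd' k with ⟨c, rfl | rfl⟩
    · rw [hortonArea_even]
      exact mul_ne_zero (by positivity) (ih c (by omega) (by omega) (by omega) (by omega))
    · exact (E (by omega) (by omega) (by omega)).ne'
    · rw [← hc, ← hc, ← neg_ne_zero, ← hortonArea_swap]
      exact (E (by omega) (by omega) (by omega)).ne'
    · rw [← hc]
      exact (O (by omega) (by omega) (by omega)).ne
    · rw [← hc]
      exact (E (by omega) (by omega) (by omega)).ne'
    · rw [← hc, ← hc, ← neg_ne_zero, ← hortonArea_swap]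
      exact (O (by omega) (by omega) (by omega)).ne
    · exact (O (by omega) (by omega) (by omega)).ne
    · rw [hortonArea_odd]
      exact mul_ne_zero (by positivity) (ih c (by omega) (by omega) (by omega) (by omega))

/-! ### Counting index sets -/

open Classical in
/-- The subsets `W` of `{0, …, m - 1}` such that `T u v q` holds whenever `u, v ∈ W` and
`u < q < v`. -/
def betweenFamily (T : ℕ → ℕ → ℕ → Prop) (m : ℕ) : Finset (Finset ℕ) :=
  (Finset.range m).powerset.filter
    fun W => ∀ u ∈ W, ∀ v ∈ W, ∀ q, u < q → q < v → T u v q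

theorem mem_betweenFamily {T : ℕ → ℕ → ℕ → Prop} {m : ℕ} {W : Finset ℕ} :
    W ∈ betweenFamily T m ↔ W ⊆ Finset.range m ∧
      ∀ u ∈ W, ∀ v ∈ W, ∀ q, u < q → q < v → T u v q := by
  simp [betweenFamily]

/-- Only the empty set, singletons and pairs of consecutive indices leave no index in between. -/
theorem card_betweenFamily_false (m : ℕ) :
    (betweenFamily (fun _ _ _ => False) m).card ≤ 2 * m + 1 := by
  have hsub : betweenFamily (fun _ _ _ => False) m ⊆
      insert ∅ ((Finset.range m).image (fun i => ({i} : Finset ℕ)) ∪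
        (Finset.range m).image (fun i => ({i, i + 1} : Finset ℕ))) := by
    intro W hW
    obtain ⟨hW, hT⟩ := mem_betweenFamily.1 hW
    rcases W.eq_empty_or_nonempty with rfl | hne
    · simp
    · refine Finset.mem_insert_of_mem ?_
      have hmin := W.min'_mem hne
      set i := W.min' hne
      have hi : i ∈ Finset.range m := hW hmin
      have hle : ∀ v ∈ W, v = i ∨ v = i + 1 := by
        intro v hv
        have h1 : i ≤ v := W.min'_le v hv
        by_contra hcon
        exact hT i hmin v hv (i + 1) (by omega) (by omega)
      by_cases h1 : i + 1 ∈ W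
      · refine Finset.mem_union_right _ (Finset.mem_image.2 ⟨i, hi, ?_⟩)
        ext v
        simp only [Finset.mem_insert, Finset.mem_singleton]
        exact ⟨by rintro (rfl | rfl) <;> assumption, hle v⟩
      · refine Finset.mem_union_left _ (Finset.mem_image.2 ⟨i, hi, ?_⟩)
        ext v
        simp only [Finset.mem_singleton]
        exact ⟨by rintro rfl; assumption,
          fun hv => (hle v hv).resolve_right (by rintro rfl; exact h1 hv)⟩
  have h1 := Finset.card_le_card hsub
  have h2 := Finset.card_insert_le (∅ : Finset ℕ)
    ((Finset.range m).image (fun i => ({i} : Finset ℕ)) ∪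
        (Finset.range m).image (fun i => ({i, i + 1} : Finset ℕ)))
  have h3 := Finset.card_union_le ((Finset.range m).image (fun i => ({i} : Finset ℕ)))
        ((Finset.range m).image (fun i => ({i, i + 1} : Finset ℕ)))
  have h4 := Finset.card_image_le (s := Finset.range m) (f := fun i => ({i} : Finset ℕ))
  have h5 := Finset.card_image_le (s := Finset.range m) (f := fun i => ({i, i + 1} : Finset ℕ))
  simp only [Finset.card_range] at h4 h5
  omega

/-- If the condition `T` is self-similar on the indices of parity `b` and fails whenever it would
allow an index of the other parity to be joined to a non-neighbour, then only linearly many index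
sets satisfy it. -/
theorem card_betweenFamily_le {T : ℕ → ℕ → ℕ → Prop} {N b : ℕ} (hb : b < 2)
    (hself : ∀ u v q, T (2 * u + b) (2 * v + b) (2 * q + b) → T u v q)
    (hother : ∀ u v, u < v → 2 * v + (1 - b) < N →
      ¬ T (2 * u + (1 - b)) (2 * v + (1 - b)) (2 * u + (1 - b) + 1))
    (hleft : ∀ u q w, u < q → 2 * q + b < 2 * w + (1 - b) → 2 * w + (1 - b) < N →
      ¬ T (2 * u + b) (2 * w + (1 - b)) (2 * q + b))
    (hright : ∀ u q w, q < u → 2 * w + (1 - b) < 2 * q + b → 2 * u + b < N →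
      ¬ T (2 * w + (1 - b)) (2 * u + b) (2 * q + b))
    (m : ℕ) (hm : m ≤ N) : (betweenFamily T m).card ≤ 4 * m + 1 := by
  induction m using Nat.strong_induction_on with
  | _ m ih =>
    rcases Nat.lt_or_ge m 2 with hm2 | hm2
    · have h1 : (betweenFamily T m).card ≤ 2 ^ m := by
        refine (Finset.card_le_card fun W hW =>
          Finset.mem_powerset.2 (mem_betweenFamily.1 hW).1).trans ?_
        simp
      interval_cases m <;> omega
    -- The number of indices below `m` of parity `b`; the other `m - m'` indices cost at most 4 sets
    -- each, whence the slope 4 of the bound.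
    set m' := (m + 1 - b) / 2 with hm'
    -- Either every index has parity `b`, or an index of the other parity occurs and the rest lies
    -- among its two neighbours. If that index is 0, truncated subtraction makes the left neighbour
    -- 0 itself, which is harmless.
    have hsub : betweenFamily T m ⊆
        (betweenFamily T m').image (fun W => W.image (fun t => 2 * t + b)) ∪
        (Finset.range (m - m')).biUnion fun t =>
          (({2 * t + (1 - b) - 1, 2 * t + (1 - b) + 1} : Finset ℕ).powerset).image
            (insert (2 * t + (1 - b))) := by
      intro W hW
      obtain ⟨hW, hT⟩ := mem_betweenFamily.1 hW
      have hlt : ∀ v ∈ W, v < m := fun v hv => Finset.mem_range.1 (hW hv)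
      by_cases hex : ∃ t, 2 * t + (1 - b) ∈ W
      · obtain ⟨t, ht⟩ := hex
        refine Finset.mem_union_right _ (Finset.mem_biUnion.2 ⟨t, ?_, ?_⟩)
        · have := hlt _ ht
          rw [Finset.mem_range]; omega
        · refine Finset.mem_image.2 ⟨W.erase (2 * t + (1 - b)), ?_, Finset.insert_erase ht⟩
          rw [Finset.mem_powerset]
          intro v hv
          obtain ⟨hvt, hvW⟩ := Finset.mem_erase.1 hv
          have hvm := hlt v hvW
          have htm := hlt _ ht
          by_cases hpar : v % 2 = b
          · obtain ⟨u, rfl⟩ : ∃ u, v = 2 * u + b := ⟨v / 2, by omega⟩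
            by_contra hcon
            simp only [Finset.mem_insert, Finset.mem_singleton, not_or] at hcon
            rcases Nat.lt_or_ge (2 * u + b) (2 * t + (1 - b)) with hlt' | hge
            -- For a non-neighbour, the next index of parity `b` towards `2 * t + (1 - b)` lies
            -- strictly in between.
            · exact hleft u (u + 1) t (by omega) (by omega) (by omega)
                (hT _ hvW _ ht _ (by omega) (by omega))
            · exact hright u (u - 1) t (by omega) (by omega) (by omega)
                (hT _ ht _ hvW _ (by omega) (by omega))
          · obtain ⟨u, rfl⟩ : ∃ u, v = 2 * u + (1 - b) := ⟨v / 2, by omega⟩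
            rcases Nat.lt_trichotomy u t with h | h | h
            · exact absurd (hT _ hvW _ ht _ (by omega) (by omega)) (hother u t h (by omega))
            · exact absurd (by rw [h]) hvt
            · exact absurd (hT _ ht _ hvW _ (by omega) (by omega)) (hother t u h (by omega))
      · push Not at hex
        have hall : ∀ v ∈ W, v = 2 * (v / 2) + b := by
          intro v hv
          have := hex (v / 2)
          by_contra hcon
          refine this ?_
          rwa [show 2 * (v / 2) + (1 - b) = v by omega]
        refine Finset.mem_union_left _ (Finset.mem_image.2 ⟨W.image (· / 2), ?_, ?_⟩)
        · rw [mem_betweenFamily]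
          refine ⟨?_, ?_⟩
          · intro t ht
            obtain ⟨v, hv, rfl⟩ := Finset.mem_image.1 ht
            have := hlt v hv
            have := hall v hv
            rw [Finset.mem_range]; omega
          · simp only [Finset.mem_image]
            rintro _ ⟨u, hu, rfl⟩ _ ⟨v, hv, rfl⟩ q h1 h2
            apply hself
            rw [← hall u hu, ← hall v hv]
            have := hall u hu
            have := hall v hv
            exact hT u hu v hv _ (by omega) (by omega)
        · rw [Finset.image_image]
          ext v
          simp only [Finset.mem_image, Function.comp]
          constructor
          · rintro ⟨u, hu, rfl⟩
            rwa [← hall u hu]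
          · intro hv
            exact ⟨v, hv, (hall v hv).symm⟩
    have h1 := Finset.card_le_card hsub
    have h2 := Finset.card_union_le
      ((betweenFamily T m').image (fun W => W.image (fun t => 2 * t + b)))
      ((Finset.range (m - m')).biUnion fun t =>
          (({2 * t + (1 - b) - 1, 2 * t + (1 - b) + 1} : Finset ℕ).powerset).image
            (insert (2 * t + (1 - b))))
    have h3 := (Finset.card_image_le (s := betweenFamily T m')
      (f := fun W => W.image (fun t => 2 * t + b))).trans (ih m' (by omega) (by omega))
    have h4 := Finset.card_biUnion_le_card_mul (Finset.range (m - m'))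
      (fun t => (({2 * t + (1 - b) - 1, 2 * t + (1 - b) + 1} : Finset ℕ).powerset).image
            (insert (2 * t + (1 - b)))) 4 (by
        intro t _
        refine Finset.card_image_le.trans ?_
        rw [Finset.card_powerset]
        exact (Nat.pow_le_pow_right (by norm_num) Finset.card_le_two).trans (by norm_num))
    rw [Finset.card_range] at h4
    omega

/-! ### Counting caps, cups and holes of Horton sets -/

/-- Index sets of caps of a Horton set with no point below them. -/
def hortonCaps (ε : ℝ) (m : ℕ) : Finset (Finset ℕ) :=
  betweenFamily (fun u v q => 0 ≤ hortonArea ε u v q) m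

/-- Index sets of cups of a Horton set with no point above them. -/
def hortonCups (ε : ℝ) (m : ℕ) : Finset (Finset ℕ) :=
  betweenFamily (fun u v q => hortonArea ε u v q ≤ 0) m

/-- Even points lie deep below odd ones. A segment from an odd point to a non-neighbour thus passes
above an even point, so the recursion runs along the even indices, `b = 0`. For cups the parities
exchange roles. -/
theorem card_hortonCaps {ε : ℝ} {N : ℕ} (h0 : 0 < ε) (hε : ε * (N + 4) ≤ 1) {m : ℕ}
    (hm : m ≤ N) : (hortonCaps ε m).card ≤ 4 * m + 1 := by
  refine card_betweenFamily_le (N := N) (b := 0) (by norm_num) ?_ ?_ ?_ ?_ m hm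
  · intro u v q h
    rw [add_zero, add_zero, add_zero, hortonArea_even] at h
    exact nonneg_of_mul_nonneg_right h (by positivity)
  · intro u v huv hv
    rw [not_le]
    exact hortonArea_odd_odd_even (k := u + 1) h0 hε huv hv (by omega)
  · intro u q w h1 h2 h3
    rw [not_le, ← hortonArea_cyclic, ← hortonArea_cyclic, ← neg_pos, ← hortonArea_swap]
    exact hortonArea_even_even_odd h0 hε h1 (by omega) h3
  · intro u q w h1 h2 h3
    rw [not_le, ← hortonArea_cyclic, ← neg_pos, ← hortonArea_swap]
    exact hortonArea_even_even_odd h0 hε h1 (by omega) (by omega)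

theorem card_hortonCups {ε : ℝ} {N : ℕ} (h0 : 0 < ε) (hε : ε * (N + 4) ≤ 1) {m : ℕ}
    (hm : m ≤ N) : (hortonCups ε m).card ≤ 4 * m + 1 := by
  refine card_betweenFamily_le (N := N) (b := 1) (by norm_num) ?_ ?_ ?_ ?_ m hm
  · intro u v q h
    rw [hortonArea_odd] at h
    by_contra hcon
    have : 0 < 2 * ε * hortonArea ε u v q := mul_pos (by positivity) (not_le.1 hcon)
    linarith
  · intro u v huv hv
    rw [not_le]
    exact hortonArea_even_even_odd h0 hε huv hv (by omega)
  · intro u q w h1 h2 h3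
    rw [not_le, ← hortonArea_cyclic, ← hortonArea_cyclic, ← neg_lt_zero, ← hortonArea_swap]
    exact hortonArea_odd_odd_even h0 hε h1 (by omega) h3
  · intro u q w h1 h2 h3
    rw [not_le, ← hortonArea_cyclic, ← neg_lt_zero, ← hortonArea_swap]
    exact hortonArea_odd_odd_even h0 hε h1 (by omega) (by omega)

open Classical in
/-- The index sets such that no point of the Horton set is interior to a triangle spanned by
them. -/
def hortonHoles (ε : ℝ) (m : ℕ) : Finset (Finset ℕ) :=
  (Finset.range m).powerset.filter fun W => ∀ u ∈ W, ∀ v ∈ W, ∀ w ∈ W, ∀ q < m,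
    ¬ (0 < hortonArea ε u v q ∧ 0 < hortonArea ε v w q ∧ 0 < hortonArea ε w u q)

theorem mem_hortonHoles {ε : ℝ} {m : ℕ} {W : Finset ℕ} :
    W ∈ hortonHoles ε m ↔ W ⊆ Finset.range m ∧ ∀ u ∈ W, ∀ v ∈ W, ∀ w ∈ W, ∀ q < m,
      ¬ (0 < hortonArea ε u v q ∧ 0 < hortonArea ε v w q ∧ 0 < hortonArea ε w u q) := by
  simp [hortonHoles]

theorem card_hortonHoles {ε : ℝ} {N : ℕ} (h0 : 0 < ε) (hε : ε * (N + 4) ≤ 1) (m : ℕ)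
    (hm : m ≤ N) : (hortonHoles ε m).card ≤ 13 * m ^ 2 + 1 := by
  induction m using Nat.strong_induction_on with
  | _ m ih =>
    rcases Nat.lt_or_ge m 2 with hm2 | hm2
    · have h1 : (hortonHoles ε m).card ≤ 2 ^ m := by
        refine (Finset.card_filter_le _ _).trans ?_
        simp
      interval_cases m <;> omega
    obtain ⟨a, ha⟩ : ∃ a, a = (m + 1) / 2 := ⟨_, rfl⟩
    obtain ⟨b, hb⟩ : ∃ b, b = m / 2 := ⟨_, rfl⟩
    set e : Finset ℕ → Finset ℕ := fun W => W.image (fun t => 2 * t)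
    set o : Finset ℕ → Finset ℕ := fun W => W.image (fun t => 2 * t + 1)
    -- A set of one parity is a set of the same kind in a half-size Horton set. In a mixed set the
    -- even part is seen from above by an odd point and the odd part from below by an even point, so
    -- they are a cup and a cap.
    have hsub : hortonHoles ε m ⊆ ((hortonHoles ε a).image e ∪ (hortonHoles ε b).image o) ∪
        (hortonCups ε a ×ˢ hortonCaps ε b).image (fun x => e x.1 ∪ o x.2) := by
      intro W hW
      obtain ⟨hW, hT⟩ := mem_hortonHoles.1 hW
      set W₀ := (Finset.range a).filter (fun t => 2 * t ∈ W)
      set W₁ := (Finset.range b).filter (fun t => 2 * t + 1 ∈ W)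
      have hmem0 : ∀ t, t ∈ W₀ ↔ 2 * t ∈ W := by
        intro t
        simp only [W₀, Finset.mem_filter, Finset.mem_range, and_iff_right_iff_imp]
        intro h
        have := Finset.mem_range.1 (hW h)
        omega
      have hmem1 : ∀ t, t ∈ W₁ ↔ 2 * t + 1 ∈ W := by
        intro t
        simp only [W₁, Finset.mem_filter, Finset.mem_range, and_iff_right_iff_imp]
        intro h
        have := Finset.mem_range.1 (hW h)
        omega
      have hWe : W = e W₀ ∪ o W₁ := by
        ext v
        simp only [e, o, Finset.mem_union, Finset.mem_image, hmem0, hmem1]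
        constructor
        · intro hv
          rcases Nat.even_or_odd' v with ⟨t, rfl | rfl⟩
          · exact Or.inl ⟨t, hv, rfl⟩
          · exact Or.inr ⟨t, hv, rfl⟩
        · rintro (⟨t, h, rfl⟩ | ⟨t, h, rfl⟩) <;> exact h
      have hpos : ∀ r : ℝ, 0 < r → 0 < 2 * ε * r := fun r hr => by positivity
      rcases W₁.eq_empty_or_nonempty with h1 | ⟨w₁, h1⟩
      · refine Finset.mem_union_left _ (Finset.mem_union_left _
          (Finset.mem_image.2 ⟨W₀, ?_, ?_⟩))
        · refine mem_hortonHoles.2 ⟨Finset.filter_subset _ _, ?_⟩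
          intro u hu v hv w hw q hq ⟨x, y, z⟩
          refine hT (2 * u) ((hmem0 u).1 hu) (2 * v) ((hmem0 v).1 hv) (2 * w) ((hmem0 w).1 hw)
            (2 * q) (by omega) ?_
          simp only [hortonArea_even]
          exact ⟨hpos _ x, hpos _ y, hpos _ z⟩
        · rw [hWe, h1]; simp [o]
      rcases W₀.eq_empty_or_nonempty with h2 | ⟨w₀, h2⟩
      · refine Finset.mem_union_left _ (Finset.mem_union_right _
          (Finset.mem_image.2 ⟨W₁, ?_, ?_⟩))
        · refine mem_hortonHoles.2 ⟨Finset.filter_subset _ _, ?_⟩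
          intro u hu v hv w hw q hq ⟨x, y, z⟩
          refine hT (2 * u + 1) ((hmem1 u).1 hu) (2 * v + 1) ((hmem1 v).1 hv) (2 * w + 1)
            ((hmem1 w).1 hw) (2 * q + 1) (by omega) ?_
          simp only [hortonArea_odd]
          exact ⟨hpos _ x, hpos _ y, hpos _ z⟩
        · rw [hWe, h2]; simp [e]
      · refine Finset.mem_union_right _ (Finset.mem_image.2 ⟨(W₀, W₁), ?_, hWe.symm⟩)
        have hw₀ := Finset.mem_range.1 (hW ((hmem0 w₀).1 h2))
        have hw₁ := Finset.mem_range.1 (hW ((hmem1 w₁).1 h1))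
        rw [Finset.mem_product]
        refine ⟨mem_betweenFamily.2 ⟨Finset.filter_subset _ _, ?_⟩,
          mem_betweenFamily.2 ⟨Finset.filter_subset _ _, ?_⟩⟩
        -- An even point above the segment from `2 * u` to `2 * v` would be interior to the triangle
        -- with apex `2 * w₁ + 1`.
        · intro u hu v hv q huq hqv
          by_contra hcon
          have hv' := Finset.mem_range.1 (hW ((hmem0 v).1 hv))
          refine hT (2 * u) ((hmem0 u).1 hu) (2 * v) ((hmem0 v).1 hv) (2 * w₁ + 1)
            ((hmem1 w₁).1 h1) (2 * q) (by omega) ⟨?_, ?_, ?_⟩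
          · rw [hortonArea_even]
            exact hpos _ (not_le.1 hcon)
          · rw [← hortonArea_cyclic, ← hortonArea_cyclic]
            exact hortonArea_even_even_odd h0 hε hqv (by omega) (by omega)
          · rw [← hortonArea_cyclic]
            exact hortonArea_even_even_odd h0 hε huq (by omega) (by omega)
        · intro u hu v hv q huq hqv
          by_contra hcon
          have hv' := Finset.mem_range.1 (hW ((hmem1 v).1 hv))
          refine hT (2 * v + 1) ((hmem1 v).1 hv) (2 * u + 1) ((hmem1 u).1 hu) (2 * w₀)
            ((hmem0 w₀).1 h2) (2 * q + 1) (by omega) ⟨?_, ?_, ?_⟩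
          · rw [hortonArea_odd, hortonArea_swap]
            exact hpos _ (neg_pos.2 (not_le.1 hcon))
          · rw [← hortonArea_cyclic, ← hortonArea_cyclic, hortonArea_swap, neg_pos]
            exact hortonArea_odd_odd_even h0 hε huq (by omega) (by omega)
          · rw [← hortonArea_cyclic, hortonArea_swap, neg_pos]
            exact hortonArea_odd_odd_even h0 hε hqv (by omega) (by omega)
    have h1 := (Finset.card_le_card hsub).trans ((Finset.card_union_le _ _).trans
      (Nat.add_le_add ((Finset.card_union_le _ _).trans
        (Nat.add_le_add Finset.card_image_le Finset.card_image_le)) Finset.card_image_le))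
    rw [Finset.card_product] at h1
    have h2 := ih a (by omega) (by omega)
    have h3 := ih b (by omega) (by omega)
    have h4 := Nat.mul_le_mul (card_hortonCups h0 hε (by omega : a ≤ N))
      (card_hortonCaps h0 hε (by omega : b ≤ N))
    have hab : m = a + b := by omega
    have ha1 : 1 ≤ a := by omega
    have hb1 : 1 ≤ b := by omega
    -- Here `26 * a * b` is the cross term of `13 * (a + b) ^ 2`; equality holds at `a = b = 1`,
    -- which fixes the constant 13.
    have h5 : (4 * a + 1) * (4 * b + 1) + 1 ≤ 26 * a * b := by
      nlinarith [Nat.mul_le_mul ha1 hb1, Nat.mul_le_mul_left a hb1, Nat.mul_le_mul_right b ha1]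
    subst hab
    nlinarith

/-! ### Oriented areas in the plane -/

/-- Twice the signed area of the triangle `pqr`. -/
def area (p q r : Plane) : ℝ := (q 0 - p 0) * (r 1 - p 1) - (q 1 - p 1) * (r 0 - p 0)

theorem area_cyclic (p q r : Plane) : area q r p = area p q r := by
  unfold area; ring

theorem area_swap (p q r : Plane) : area q p r = -area p q r := by
  unfold area; ring

theorem not_collinear_of_area_ne_zero {p q r : Plane} (h : area p q r ≠ 0) :
    ¬ Collinear ℝ ({p, q, r} : Set Plane) := by
  intro hc
  obtain ⟨v, hv⟩ := (collinear_iff_of_mem (p₀ := p) (by simp)).1 hc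
  obtain ⟨s, rfl⟩ := hv q (by simp)
  obtain ⟨t, rfl⟩ := hv r (by simp)
  apply h
  simp [area]
  ring

theorem mem_interior_triangle {u v w q : Plane} (h1 : 0 < area u v q) (h2 : 0 < area v w q)
    (h3 : 0 < area w u q) : q ∈ interior (convexHull ℝ ({u, v, w} : Set Plane)) := by
  have hopen : IsOpen {x : Plane | 0 < area u v x ∧ 0 < area v w x ∧ 0 < area w u x} := by
    have hc : ∀ u v : Plane, Continuous fun x => area u v x := fun u v => by
      unfold area; fun_prop
    exact (isOpen_lt continuous_const (hc _ _)).inter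
      ((isOpen_lt continuous_const (hc _ _)).inter (isOpen_lt continuous_const (hc _ _)))
  refine interior_maximal ?_ hopen ⟨h1, h2, h3⟩
  rintro x ⟨g1, g2, g3⟩
  have hD : 0 < area u v x + area v w x + area w u x := by linarith
  set D := area u v x + area v w x + area w u x with hDdef
  -- Barycentric coordinates as quotients of areas; `D` is the area of `uvw`.
  have hx : x = (area v w x / D) • u + (area w u x / D) • v + (area u v x / D) • w := by
    ext i
    fin_cases i <;>
    · simp only [PiLp.add_apply, PiLp.smul_apply, smul_eq_mul, Fin.zero_eta, Fin.mk_one]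
      field_simp
      rw [hDdef]
      simp only [area]
      ring
  have hs := convex_convexHull ℝ ({u, v, w} : Set Plane)
  have hu : u ∈ convexHull ℝ ({u, v, w} : Set Plane) := subset_convexHull _ _ (by simp)
  have hv : v ∈ convexHull ℝ ({u, v, w} : Set Plane) := subset_convexHull _ _ (by simp)
  have hw : w ∈ convexHull ℝ ({u, v, w} : Set Plane) := subset_convexHull _ _ (by simp)
  have hsum : area v w x / D + area w u x / D + area u v x / D = 1 := by
    field_simp; rw [hDdef]; ring
  have key := hs.sum_mem (t := Finset.univ)
    (w := ![area v w x / D, area w u x / D, area u v x / D]) (z := ![u, v, w])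
    (by intro i _; fin_cases i <;> simp <;> positivity)
    (by simpa [Fin.sum_univ_three] using hsum)
    (by intro i _; fin_cases i <;> simp [hu, hv, hw])
  rw [hx]
  simpa [Fin.sum_univ_three] using key

/-- A point on the same side of `uv` as `w`, such that `w` lies on this side of `uq` and `qv` as
well, is interior to the triangle `uvw`. -/
theorem mem_interior_triangle_of_visible {u v w q : Plane} (h1 : 0 < area u v q)
    (h2 : 0 < area u q w) (h3 : 0 < area q v w) :
    q ∈ interior (convexHull ℝ ({u, v, w} : Set Plane)) := by
  refine mem_interior_triangle h1 ?_ ?_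
  · rwa [← area_cyclic, ← area_cyclic]
  · rwa [← area_cyclic]

theorem mem_interior_triangle_of_visible' {u v w q : Plane} (h1 : area u v q < 0)
    (h2 : area u q w < 0) (h3 : area q v w < 0) :
    q ∈ interior (convexHull ℝ ({u, v, w} : Set Plane)) := by
  rw [Set.insert_comm]
  refine mem_interior_triangle_of_visible ?_ ?_ ?_ <;> rw [area_swap, neg_pos] <;> assumption

/-- No point of `S` is interior to a triangle with vertices in `I`. -/
def TrianglesEmpty (S : Finset Plane) (I : Finset Plane) : Prop :=
  ∀ u ∈ I, ∀ v ∈ I, ∀ w ∈ I, ∀ q ∈ S, q ∉ interior (convexHull ℝ ({u, v, w} : Set Plane))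

/-- For an upper bound convex position may be forgotten: emptiness of the triangles is all that the
count needs. -/
theorem IsAffineKHole.exists_trianglesEmpty {S : Finset Plane} {k : ℕ} {H : Set Plane}
    (h : IsAffineKHole S k H) :
    ∃ I : Finset Plane, I ⊆ S ∧ H = convexHull ℝ (I : Set Plane) ∧ TrianglesEmpty S I := by
  obtain ⟨I, hI, -, -, rfl, hdisj⟩ := h
  refine ⟨I, hI, rfl, fun u hu v hv w hw q hq hmem => ?_⟩
  refine Set.disjoint_left.1 hdisj (interior_mono (convexHull_mono ?_) hmem) hq
  rintro x (rfl | rfl | rfl) <;> assumption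

/-- The chain bulges towards `w`, so a chain point between two chosen ones lies inside the triangle
that these span with `w`. -/
theorem TrianglesEmpty.mem_betweenFamily_false {S I : Finset Plane} (hI : TrianglesEmpty S I)
    {a : ℕ → Plane} {p : ℕ} (ha : ∀ i < p, a i ∈ S) {w : Plane} (hw : w ∈ I)
    (hchain : ∀ i j k, i < j → j < k → area (a i) (a k) (a j) < 0)
    (hvis : ∀ i j, i < j → area (a i) (a j) w < 0) {α : Finset ℕ} (hα : α ⊆ Finset.range p)
    (hαI : ∀ i ∈ α, a i ∈ I) : α ∈ betweenFamily (fun _ _ _ => False) p := by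
  refine mem_betweenFamily.2 ⟨hα, fun u hu v hv q huq hqv => ?_⟩
  have hv' := Finset.mem_range.1 (hα hv)
  exact hI _ (hαI u hu) _ (hαI v hv) _ hw _ (ha q (by omega))
    (mem_interior_triangle_of_visible' (hchain _ _ _ huq hqv) (hvis _ _ huq) (hvis _ _ hqv))

/-! ### The point set -/

/-- The point of the hyperbola `xy = 1` with abscissa `t`. -/
def hyperbolaPoint (t : ℝ) : Plane := !₂[t, t⁻¹]

/-- Abscissas of the points on the upper branch of the hyperbola. -/
def upperParam (j : ℕ) : ℝ := 2 - 1 / (j + 1)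

/-- Abscissas of the points on the lower branch of the hyperbola. -/
def lowerParam (j : ℕ) : ℝ := 1 / (j + 1) - 4

/-- The points of a flat Horton set between the branches of the hyperbola. -/
def hortonPoint (m i : ℕ) : Plane :=
  !₂[(i : ℝ) / (m + 1), hortonHeight (1 / ((m : ℝ) + 4)) i / (64 * (m + 1))]

theorem one_div_succ_mem (j : ℕ) : (0 : ℝ) < 1 / (j + 1) ∧ (1 : ℝ) / (j + 1) ≤ 1 := by
  refine ⟨by positivity, ?_⟩
  rw [div_le_one (by positivity)]
  linarith [j.cast_nonneg (α := ℝ)]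

theorem one_div_succ_lt {i j : ℕ} (h : i < j) : (1 : ℝ) / (j + 1) < 1 / (i + 1) := by
  have : (i : ℝ) < j := by exact_mod_cast h
  gcongr

theorem upperParam_mem (j : ℕ) : 1 ≤ upperParam j ∧ upperParam j < 2 := by
  have := one_div_succ_mem j
  unfold upperParam; constructor <;> linarith

theorem lowerParam_mem (j : ℕ) : -4 < lowerParam j ∧ lowerParam j ≤ -3 := by
  have := one_div_succ_mem j
  unfold lowerParam; constructor <;> linarith

theorem upperParam_strictMono : StrictMono upperParam := fun i j h => by
  have := one_div_succ_lt h
  unfold upperParam; linarith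

theorem lowerParam_strictAnti : StrictAnti lowerParam := fun i j h => by
  have := one_div_succ_lt h
  unfold lowerParam; linarith

theorem area_hyperbolaPoint {r s : ℝ} (hr : r ≠ 0) (hs : s ≠ 0) (w : Plane) :
    area (hyperbolaPoint r) (hyperbolaPoint s) w =
      (s - r) / (r * s) * (r * s * w 1 + w 0 - r - s) := by
  simp [area, hyperbolaPoint]
  field_simp
  ring

theorem area_hyperbolaPoint₃ {r s t : ℝ} (hr : r ≠ 0) (hs : s ≠ 0) (ht : t ≠ 0) :
    area (hyperbolaPoint r) (hyperbolaPoint s) (hyperbolaPoint t) =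
      (s - r) / (r * s) * ((t - r) * (t - s) / t) := by
  rw [area_hyperbolaPoint hr hs]
  simp [hyperbolaPoint]
  left
  field_simp
  ring

theorem area_upper_chain {i j k : ℕ} (hij : i < j) (hjk : j < k) :
    area (hyperbolaPoint (upperParam i)) (hyperbolaPoint (upperParam k))
      (hyperbolaPoint (upperParam j)) < 0 := by
  have h1 := upperParam_strictMono hij
  have h2 := upperParam_strictMono hjk
  have hi := upperParam_mem i
  have hj := upperParam_mem j
  have hk := upperParam_mem k
  rw [area_hyperbolaPoint₃ (by linarith) (by linarith) (by linarith)]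
  refine mul_neg_of_pos_of_neg (div_pos (by linarith) (by nlinarith)) ?_
  exact div_neg_of_neg_of_pos (mul_neg_of_pos_of_neg (by linarith) (by linarith)) (by linarith)

/-- The lower branch is numbered from right to left, so that its orientation signs agree with those
of the upper branch. -/
theorem area_lower_chain {i j k : ℕ} (hij : i < j) (hjk : j < k) :
    area (hyperbolaPoint (lowerParam i)) (hyperbolaPoint (lowerParam k))
      (hyperbolaPoint (lowerParam j)) < 0 := by
  have h1 := lowerParam_strictAnti hij
  have h2 := lowerParam_strictAnti hjk
  have hi := lowerParam_mem i
  have hj := lowerParam_mem j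
  have hk := lowerParam_mem k
  rw [area_hyperbolaPoint₃ (by linarith) (by linarith) (by linarith)]
  refine mul_neg_of_neg_of_pos (div_neg_of_neg_of_pos (by linarith) (by nlinarith)) ?_
  exact div_pos_of_neg_of_neg (mul_neg_of_neg_of_pos (by linarith) (by linarith)) (by linarith)

/-- Since `r * s ≤ 4` and `r + s ≥ 2`, the second factor is below `4 / 32 + 1 - 2 < 0`: chords of
the upper branch pass above the rest of the set. -/
theorem area_upper_upper {i j : ℕ} (hij : i < j) {w : Plane} (h0 : w 0 < 1) (h1 : w 1 ≤ 1 / 32) :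
    area (hyperbolaPoint (upperParam i)) (hyperbolaPoint (upperParam j)) w < 0 := by
  have h2 := upperParam_strictMono hij
  have hi := upperParam_mem i
  have hj := upperParam_mem j
  rw [area_hyperbolaPoint (by linarith) (by linarith)]
  refine mul_neg_of_pos_of_neg (div_pos (by linarith) (by nlinarith)) ?_
  have h3 : upperParam i * upperParam j ≤ 4 := by nlinarith
  have h4 : 0 < upperParam i * upperParam j := by nlinarith
  nlinarith

theorem area_lower_lower {i j : ℕ} (hij : i < j) {w : Plane} (h0 : 0 ≤ w 0) (h1 : 0 ≤ w 1) :
    area (hyperbolaPoint (lowerParam i)) (hyperbolaPoint (lowerParam j)) w < 0 := by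
  have h2 := lowerParam_strictAnti hij
  have hi := lowerParam_mem i
  have hj := lowerParam_mem j
  have h4 : 0 < lowerParam i * lowerParam j := by nlinarith
  rw [area_hyperbolaPoint (by linarith) (by linarith)]
  refine mul_neg_of_neg_of_pos (div_neg_of_neg_of_pos (by linarith) h4) ?_
  nlinarith [mul_nonneg h4.le h1]

/-- The two parameter ranges are not symmetric: `-r - s > 1` outweighs `r * s * w 1 ≥ -8 / 32`, so
every line joining the branches misses the Horton region. This serves general position only. -/
theorem area_upper_lower_pos {i j : ℕ} {w : Plane} (h0 : 0 ≤ w 0) (h1 : 0 ≤ w 1)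
    (h2 : w 1 ≤ 1 / 32) :
    0 < area (hyperbolaPoint (upperParam i)) (hyperbolaPoint (lowerParam j)) w := by
  have hi := upperParam_mem i
  have hj := lowerParam_mem j
  have h4 : upperParam i * lowerParam j < 0 := by nlinarith
  have h5 : -8 ≤ upperParam i * lowerParam j := by nlinarith
  rw [area_hyperbolaPoint (by linarith) (by linarith)]
  refine mul_pos (div_pos_of_neg_of_neg (by linarith) h4) ?_
  nlinarith

theorem hortonPoint_mem {m i : ℕ} (hi : i < m) :
    (0 ≤ hortonPoint m i 0 ∧ hortonPoint m i 0 < 1) ∧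
      (0 ≤ hortonPoint m i 1 ∧ hortonPoint m i 1 ≤ 1 / 32) := by
  have hm : (0 : ℝ) ≤ m := m.cast_nonneg
  have hi' : (i : ℝ) < m := by exact_mod_cast hi
  have hh := hortonHeight_mem (ε := 1 / ((m : ℝ) + 4)) (by positivity)
    (by rw [div_le_div_iff₀ (by positivity) (by positivity)]; linarith) i
  simp only [hortonPoint, PiLp.toLp_apply, Matrix.cons_val_zero, Matrix.cons_val_one]
  refine ⟨⟨by positivity, ?_⟩, ⟨div_nonneg hh.1 (by positivity), ?_⟩⟩
  · rw [div_lt_one (by positivity)]; linarith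
  · rw [div_le_div_iff₀ (by positivity) (by positivity)]; nlinarith

theorem area_hortonPoint (m i j k : ℕ) :
    area (hortonPoint m i) (hortonPoint m j) (hortonPoint m k) =
      1 / (64 * ((m : ℝ) + 1) ^ 2) * hortonArea (1 / ((m : ℝ) + 4)) i j k := by
  simp only [area, hortonPoint, hortonArea, PiLp.toLp_apply, Matrix.cons_val_zero,
    Matrix.cons_val_one]
  have : (m : ℝ) + 1 ≠ 0 := by positivity
  field_simp

theorem hortonPoint_diff {m i j : ℕ} (hij : i < j) :
    1 / ((m : ℝ) + 1) ≤ hortonPoint m j 0 - hortonPoint m i 0 ∧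
      |hortonPoint m j 1 - hortonPoint m i 1| ≤ 1 / ((m : ℝ) + 1) / 32 := by
  have hm : (0 : ℝ) ≤ m := m.cast_nonneg
  have hij' : (i : ℝ) + 1 ≤ j := by exact_mod_cast hij
  have hh := hortonHeight_mem (ε := 1 / ((m : ℝ) + 4)) (by positivity)
    (by rw [div_le_div_iff₀ (by positivity) (by positivity)]; linarith)
  simp only [hortonPoint, PiLp.toLp_apply, Matrix.cons_val_zero, Matrix.cons_val_one]
  constructor
  · rw [← sub_div]; gcongr; linarith
  · rw [← sub_div, abs_div, abs_of_pos (by positivity : (0 : ℝ) < 64 * (m + 1)), div_div,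
      div_le_div_iff₀ (by positivity) (by positivity)]
    have : |hortonHeight (1 / ((m : ℝ) + 4)) j - hortonHeight (1 / ((m : ℝ) + 4)) i| ≤ 2 := by
      rw [abs_le]; constructor <;> linarith [(hh i).1, (hh i).2, (hh j).1, (hh j).2]
    nlinarith

/-- Lines through two Horton points have slope at most `1 / 32` in absolute value, while upper
points have height at least `1 / 2` and lower points at most `-1 / 4`; hence all upper points lie
above these lines and all lower points below. -/
theorem area_horton_horton_upper {m i j k : ℕ} (hij : i < j) (hj : j < m) :
    0 < area (hortonPoint m i) (hortonPoint m j) (hyperbolaPoint (upperParam k)) := by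
  obtain ⟨h1, h2⟩ := hortonPoint_diff (m := m) hij
  obtain ⟨⟨h3, h4⟩, h5, h6⟩ := hortonPoint_mem (hij.trans hj)
  have hk := upperParam_mem k
  have hd : 0 < 1 / ((m : ℝ) + 1) := by positivity
  set d := 1 / ((m : ℝ) + 1)
  have hinv : 1 / 2 ≤ (upperParam k)⁻¹ := by
    rw [one_div]; exact inv_anti₀ (by linarith) hk.2.le
  have e0 : hyperbolaPoint (upperParam k) 0 = upperParam k := by simp [hyperbolaPoint]
  have e1 : hyperbolaPoint (upperParam k) 1 = (upperParam k)⁻¹ := by simp [hyperbolaPoint]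
  unfold area
  rw [e0, e1]
  have h7 : (hortonPoint m j 1 - hortonPoint m i 1) * (upperParam k - hortonPoint m i 0)
      ≤ d / 32 * 2 := by
    refine (le_abs_self _).trans ?_
    rw [abs_mul]
    have : |upperParam k - hortonPoint m i 0| ≤ 2 := by
      rw [abs_le]; constructor <;> linarith
    gcongr
  have h8 : d * (15 / 32) ≤
      (hortonPoint m j 0 - hortonPoint m i 0) * ((upperParam k)⁻¹ - hortonPoint m i 1) := by
    refine mul_le_mul h1 (by linarith) (by norm_num) (by linarith)
  linarith

theorem area_horton_horton_lower {m i j k : ℕ} (hij : i < j) (hj : j < m) :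
    area (hortonPoint m i) (hortonPoint m j) (hyperbolaPoint (lowerParam k)) < 0 := by
  obtain ⟨h1, h2⟩ := hortonPoint_diff (m := m) hij
  obtain ⟨⟨h3, h4⟩, h5, h6⟩ := hortonPoint_mem (hij.trans hj)
  have hk := lowerParam_mem k
  have hd : 0 < 1 / ((m : ℝ) + 1) := by positivity
  set d := 1 / ((m : ℝ) + 1)
  have hinv : 1 / 4 ≤ -(lowerParam k)⁻¹ := by
    rw [one_div, ← inv_neg]; exact inv_anti₀ (by linarith) (by linarith)
  have e0 : hyperbolaPoint (lowerParam k) 0 = lowerParam k := by simp [hyperbolaPoint]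
  have e1 : hyperbolaPoint (lowerParam k) 1 = (lowerParam k)⁻¹ := by simp [hyperbolaPoint]
  unfold area
  rw [e0, e1]
  have h7 : -((hortonPoint m j 1 - hortonPoint m i 1) * (lowerParam k - hortonPoint m i 0))
      ≤ d / 32 * 5 := by
    refine (neg_le_abs _).trans ?_
    rw [abs_mul]
    have : |lowerParam k - hortonPoint m i 0| ≤ 5 := by
      rw [abs_le]; constructor <;> linarith
    gcongr
  have h8 : d * (1 / 4) ≤
      (hortonPoint m j 0 - hortonPoint m i 0) * (hortonPoint m i 1 - (lowerParam k)⁻¹) := by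
    refine mul_le_mul h1 (by linarith) (by norm_num) (by linarith)
  linarith

/-! ### The set itself: cardinality and general position -/

/-- The abscissas of the points on the hyperbola. -/
def hyperbolaParams (p q : ℕ) : Finset ℝ :=
  (Finset.range p).image upperParam ∪ (Finset.range q).image lowerParam

open Classical in
/-- The point set: `p` and `q` points on the two branches of a hyperbola and a Horton set of `m`
points between them. -/
def pointSet (p q m : ℕ) : Finset Plane :=
  (hyperbolaParams p q).image hyperbolaPoint ∪ (Finset.range m).image (hortonPoint m)

theorem mem_hyperbolaParams {p q : ℕ} {t : ℝ} :
    t ∈ hyperbolaParams p q ↔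
      (∃ i < p, upperParam i = t) ∨ (∃ j < q, lowerParam j = t) := by
  simp [hyperbolaParams]

theorem mem_pointSet {p q m : ℕ} {x : Plane} :
    x ∈ pointSet p q m ↔
      (∃ t ∈ hyperbolaParams p q, hyperbolaPoint t = x) ∨ (∃ i < m, hortonPoint m i = x) := by
  simp [pointSet]

theorem ne_zero_of_mem_hyperbolaParams {p q : ℕ} {t : ℝ} (ht : t ∈ hyperbolaParams p q) :
    t ≠ 0 := by
  rcases mem_hyperbolaParams.1 ht with ⟨i, -, rfl⟩ | ⟨i, -, rfl⟩
  · linarith [(upperParam_mem i).1]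
  · linarith [(lowerParam_mem i).2]

theorem hyperbolaPoint_injective : Function.Injective hyperbolaPoint := fun s t h => by
  simpa [hyperbolaPoint] using congrArg (fun x : Plane => x 0) h

theorem hortonPoint_injective (m : ℕ) : Function.Injective (hortonPoint m) := fun i j h => by
  have h1 := congrArg (fun x : Plane => x 0) h
  have : (m : ℝ) + 1 ≠ 0 := by positivity
  simpa [hortonPoint, div_left_inj' this] using h1

/-- This keeps the Horton points off the hyperbola and outside every projective polygon inscribed in
it. -/
theorem hortonPoint_mul_lt {m i : ℕ} (hi : i < m) :
    hortonPoint m i 0 * hortonPoint m i 1 < 1 := by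
  obtain ⟨⟨h3, h4⟩, h5, h6⟩ := hortonPoint_mem hi
  nlinarith

theorem hyperbolaPoint_ne_hortonPoint {m i : ℕ} (hi : i < m) {t : ℝ} (ht : t ≠ 0) :
    hyperbolaPoint t ≠ hortonPoint m i := by
  intro h
  have := hortonPoint_mul_lt hi
  rw [← h] at this
  simp [hyperbolaPoint, ht] at this

theorem card_hyperbolaParams (p q : ℕ) : (hyperbolaParams p q).card = p + q := by
  rw [hyperbolaParams, Finset.card_union_of_disjoint,
    Finset.card_image_of_injective _ upperParam_strictMono.injective,
    Finset.card_image_of_injective _ lowerParam_strictAnti.injective, Finset.card_range,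
    Finset.card_range]
  rw [Finset.disjoint_left]
  simp only [Finset.mem_image, not_exists, not_and]
  rintro _ ⟨i, -, rfl⟩ j - h
  linarith [(upperParam_mem i).1, (lowerParam_mem j).2]

theorem card_pointSet (p q m : ℕ) : (pointSet p q m).card = p + q + m := by
  classical
  rw [pointSet, Finset.card_union_of_disjoint,
    Finset.card_image_of_injective _ hyperbolaPoint_injective,
    Finset.card_image_of_injective _ (hortonPoint_injective m), Finset.card_range,
    card_hyperbolaParams]
  rw [Finset.disjoint_left]
  simp only [Finset.mem_image, not_exists, not_and]
  rintro _ ⟨t, ht, rfl⟩ j hj h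
  exact hyperbolaPoint_ne_hortonPoint (Finset.mem_range.1 hj)
    (ne_zero_of_mem_hyperbolaParams ht) h.symm

theorem horton_scale (m : ℕ) : 0 < 1 / ((m : ℝ) + 4) ∧ 1 / ((m : ℝ) + 4) * (m + 4) ≤ 1 := by
  have : (0 : ℝ) < (m : ℝ) + 4 := by positivity
  exact ⟨by positivity, by rw [one_div_mul_cancel this.ne']⟩

theorem area_hortonPoint_ne_zero {m i j k : ℕ} (hi : i < m) (hj : j < m) (hk : k < m)
    (hij : i ≠ j) (hik : i ≠ k) (hjk : j ≠ k) :
    area (hortonPoint m i) (hortonPoint m j) (hortonPoint m k) ≠ 0 := by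
  have key : ∀ a b c, a < b → b < c → c < m →
      area (hortonPoint m a) (hortonPoint m b) (hortonPoint m c) ≠ 0 := by
    intro a b c hab hbc hc
    rw [area_hortonPoint]
    exact mul_ne_zero (by positivity)
      (hortonArea_ne_zero (horton_scale m).1 (horton_scale m).2 hab hbc hc)
  rcases lt_or_gt_of_ne hij with h1 | h1 <;> rcases lt_or_gt_of_ne hjk with h2 | h2 <;>
    rcases lt_or_gt_of_ne hik with h3 | h3
  · exact key _ _ _ h1 h2 hk
  · omega
  · rw [← area_cyclic, ← area_cyclic, ← neg_ne_zero, ← area_swap]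
    exact key _ _ _ h3 h2 hj
  · rw [← area_cyclic, ← area_cyclic]
    exact key _ _ _ h3 h1 hj
  · rw [← neg_ne_zero, ← area_swap]
    exact key _ _ _ h1 h3 hk
  · rw [← area_cyclic]
    exact key _ _ _ h2 h3 hi
  · omega
  · rw [← area_cyclic, ← neg_ne_zero, ← area_swap]
    exact key _ _ _ h2 h1 hi

theorem area_hyperbola_hyperbola_horton_ne_zero {p q m i : ℕ} (hi : i < m) {r s : ℝ}
    (hr : r ∈ hyperbolaParams p q) (hs : s ∈ hyperbolaParams p q) (hrs : r ≠ s) :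
    area (hyperbolaPoint r) (hyperbolaPoint s) (hortonPoint m i) ≠ 0 := by
  obtain ⟨⟨h0, h1⟩, h2, h3⟩ := hortonPoint_mem hi
  rcases mem_hyperbolaParams.1 hr with ⟨a, -, rfl⟩ | ⟨a, -, rfl⟩ <;>
    rcases mem_hyperbolaParams.1 hs with ⟨b, -, rfl⟩ | ⟨b, -, rfl⟩
  · have hab : a ≠ b := fun h => hrs (by rw [h])
    rcases lt_or_gt_of_ne hab with h | h
    · exact (area_upper_upper h h1 h3).ne
    · rw [← neg_ne_zero, ← area_swap]
      exact (area_upper_upper h h1 h3).ne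
  · exact (area_upper_lower_pos h0 h2 h3).ne'
  · rw [← neg_ne_zero, ← area_swap]
    exact (area_upper_lower_pos h0 h2 h3).ne'
  · have hab : a ≠ b := fun h => hrs (by rw [h])
    rcases lt_or_gt_of_ne hab with h | h
    · exact (area_lower_lower h h0 h2).ne
    · rw [← neg_ne_zero, ← area_swap]
      exact (area_lower_lower h h0 h2).ne

theorem area_horton_horton_hyperbola_ne_zero {p q m i j : ℕ} (hi : i < m) (hj : j < m)
    (hij : i ≠ j) {r : ℝ} (hr : r ∈ hyperbolaParams p q) :
    area (hortonPoint m i) (hortonPoint m j) (hyperbolaPoint r) ≠ 0 := by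
  rcases mem_hyperbolaParams.1 hr with ⟨a, -, rfl⟩ | ⟨a, -, rfl⟩ <;>
    rcases lt_or_gt_of_ne hij with h | h
  · exact (area_horton_horton_upper h hj).ne'
  · rw [← neg_ne_zero, ← area_swap]
    exact (area_horton_horton_upper h hi).ne'
  · exact (area_horton_horton_lower h hj).ne
  · rw [← neg_ne_zero, ← area_swap]
    exact (area_horton_horton_lower h hi).ne

theorem generalPosition_pointSet (p q m : ℕ) : GeneralPosition (pointSet p q m : Set Plane) := by
  intro x hx y hy z hz hxy hxz hyz
  apply not_collinear_of_area_ne_zero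
  rw [Finset.mem_coe, mem_pointSet] at hx hy hz
  rcases hx with ⟨r, hr, rfl⟩ | ⟨i, hi, rfl⟩ <;> rcases hy with ⟨s, hs, rfl⟩ | ⟨j, hj, rfl⟩ <;>
    rcases hz with ⟨t, ht, rfl⟩ | ⟨k, hk, rfl⟩
  · have hr0 := ne_zero_of_mem_hyperbolaParams hr
    have hs0 := ne_zero_of_mem_hyperbolaParams hs
    have ht0 := ne_zero_of_mem_hyperbolaParams ht
    have h1 : s - r ≠ 0 := sub_ne_zero.2 fun h => hxy (by rw [h])
    have h2 : t - r ≠ 0 := sub_ne_zero.2 fun h => hxz (by rw [h])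
    have h3 : t - s ≠ 0 := sub_ne_zero.2 fun h => hyz (by rw [h])
    rw [area_hyperbolaPoint₃ hr0 hs0 ht0]
    positivity
  · exact area_hyperbola_hyperbola_horton_ne_zero hk hr hs fun h => hxy (by rw [h])
  · rw [← area_cyclic, ← area_cyclic]
    exact area_hyperbola_hyperbola_horton_ne_zero hj ht hr fun h => hxz (by rw [h])
  · rw [← area_cyclic]
    exact area_horton_horton_hyperbola_ne_zero hj hk (fun h => hyz (by rw [h])) hr
  · rw [← area_cyclic]
    exact area_hyperbola_hyperbola_horton_ne_zero hi hs ht fun h => hyz (by rw [h])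
  · rw [← area_cyclic, ← area_cyclic]
    exact area_horton_horton_hyperbola_ne_zero hk hi (fun h => hxz (by rw [h])) hs
  · exact area_horton_horton_hyperbola_ne_zero hi hj (fun h => hxy (by rw [h])) ht
  · exact area_hortonPoint_ne_zero hi hj hk (fun h => hxy (by rw [h])) (fun h => hxz (by rw [h]))
      (fun h => hyz (by rw [h]))

/-! ### Affine holes of the point set -/

/-- The index sets that can describe an affine hole of `pointSet p q m`. -/
def holeIndices (p q m : ℕ) : Finset (Finset ℕ × Finset ℕ × Finset ℕ) :=
  (((Finset.range p).powerset ×ˢ {∅} ×ˢ {∅} ∪ {∅} ×ˢ (Finset.range q).powerset ×ˢ {∅}) ∪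
    ({∅} ×ˢ {∅} ×ˢ hortonHoles (1 / ((m : ℝ) + 4)) m)) ∪
  ((betweenFamily (fun _ _ _ => False) p ×ˢ betweenFamily (fun _ _ _ => False) q ×ˢ
      betweenFamily (fun _ _ _ => False) m ∪
    betweenFamily (fun _ _ _ => False) p ×ˢ {∅} ×ˢ hortonCups (1 / ((m : ℝ) + 4)) m) ∪
    {∅} ×ˢ betweenFamily (fun _ _ _ => False) q ×ˢ hortonCaps (1 / ((m : ℝ) + 4)) m)

theorem card_holeIndices (p q m : ℕ) :
    (holeIndices p q m).card ≤ 2 ^ p + 2 ^ q + (13 * m ^ 2 + 1) +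
      ((2 * p + 1) * ((2 * q + 1) * (2 * m + 1)) + (2 * p + 1) * (4 * m + 1) +
        (2 * q + 1) * (4 * m + 1)) := by
  have h1 := card_hortonHoles (horton_scale m).1 (horton_scale m).2 m le_rfl
  have h2 := card_hortonCups (horton_scale m).1 (horton_scale m).2 (le_refl m)
  have h3 := card_hortonCaps (horton_scale m).1 (horton_scale m).2 (le_refl m)
  have hp := card_betweenFamily_false p
  have hq := card_betweenFamily_false q
  have hm := card_betweenFamily_false m
  refine (Finset.card_union_le _ _).trans (Nat.add_le_add ((Finset.card_union_le _ _).trans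
    (Nat.add_le_add ((Finset.card_union_le _ _).trans (Nat.add_le_add ?_ ?_)) ?_))
    ((Finset.card_union_le _ _).trans
    (Nat.add_le_add ((Finset.card_union_le _ _).trans (Nat.add_le_add ?_ ?_)) ?_)))
  all_goals simp only [Finset.card_product, Finset.card_singleton, Finset.card_powerset,
    Finset.card_range, mul_one, one_mul]
  all_goals first | rfl | assumption | gcongr

open Classical in
/-- The points of `pointSet p q m` with given indices. -/
def pointsOfIndices (m : ℕ) (x : Finset ℕ × Finset ℕ × Finset ℕ) : Finset Plane :=
  x.1.image (fun i => hyperbolaPoint (upperParam i)) ∪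
    (x.2.1.image (fun i => hyperbolaPoint (lowerParam i)) ∪ x.2.2.image (hortonPoint m))

/-- A vertex set splits into its parts on the two branches and in the Horton set, and each nonempty
part constrains the other two. Without such a constraint it lies in a single one of the three
pieces. -/
theorem TrianglesEmpty.exists_indices {p q m : ℕ} {I : Finset Plane} (hIS : I ⊆ pointSet p q m)
    (hI : TrianglesEmpty (pointSet p q m) I) :
    ∃ x ∈ holeIndices p q m, I = pointsOfIndices m x := by
  classical
  set α := (Finset.range p).filter fun i => hyperbolaPoint (upperParam i) ∈ I
  set β := (Finset.range q).filter fun i => hyperbolaPoint (lowerParam i) ∈ I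
  set W := (Finset.range m).filter fun i => hortonPoint m i ∈ I
  have hαr : α ⊆ Finset.range p := Finset.filter_subset _ _
  have hβr : β ⊆ Finset.range q := Finset.filter_subset _ _
  have hWr : W ⊆ Finset.range m := Finset.filter_subset _ _
  have hαI : ∀ i ∈ α, hyperbolaPoint (upperParam i) ∈ I := fun i hi => (Finset.mem_filter.1 hi).2
  have hβI : ∀ i ∈ β, hyperbolaPoint (lowerParam i) ∈ I := fun i hi => (Finset.mem_filter.1 hi).2
  have hWI : ∀ i ∈ W, hortonPoint m i ∈ I := fun i hi => (Finset.mem_filter.1 hi).2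
  have hWm : ∀ i ∈ W, i < m := fun i hi => Finset.mem_range.1 (hWr hi)
  have haS : ∀ i < p, hyperbolaPoint (upperParam i) ∈ pointSet p q m := fun i hi =>
    mem_pointSet.2 (Or.inl ⟨_, mem_hyperbolaParams.2 (Or.inl ⟨i, hi, rfl⟩), rfl⟩)
  have hbS : ∀ i < q, hyperbolaPoint (lowerParam i) ∈ pointSet p q m := fun i hi =>
    mem_pointSet.2 (Or.inl ⟨_, mem_hyperbolaParams.2 (Or.inr ⟨i, hi, rfl⟩), rfl⟩)
  have hzS : ∀ i < m, hortonPoint m i ∈ pointSet p q m := fun i hi =>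
    mem_pointSet.2 (Or.inr ⟨i, hi, rfl⟩)
  have hupper : ∀ i, 0 ≤ hyperbolaPoint (upperParam i) 0 ∧ 0 ≤ hyperbolaPoint (upperParam i) 1 :=
    fun i => by
      have := (upperParam_mem i).1
      simp only [hyperbolaPoint, PiLp.toLp_apply, Matrix.cons_val_zero, Matrix.cons_val_one]
      exact ⟨by linarith, by positivity⟩
  have hlower : ∀ i, hyperbolaPoint (lowerParam i) 0 < 1 ∧
      hyperbolaPoint (lowerParam i) 1 ≤ 1 / 32 := fun i => by
    have := (lowerParam_mem i).2
    simp only [hyperbolaPoint, PiLp.toLp_apply, Matrix.cons_val_zero, Matrix.cons_val_one]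
    have h2 : (lowerParam i)⁻¹ < 0 := inv_lt_zero.2 (by linarith)
    constructor <;> linarith
  have hαβ : β.Nonempty → α ∈ betweenFamily (fun _ _ _ => False) p := fun ⟨k, hk⟩ =>
    hI.mem_betweenFamily_false haS (hβI k hk) (fun _ _ _ => area_upper_chain)
      (fun _ _ h => area_upper_upper h (hlower k).1 (hlower k).2) hαr hαI
  have hαW : W.Nonempty → α ∈ betweenFamily (fun _ _ _ => False) p := fun ⟨k, hk⟩ =>
    hI.mem_betweenFamily_false haS (hWI k hk) (fun _ _ _ => area_upper_chain)
      (fun _ _ h => area_upper_upper h (hortonPoint_mem (hWm k hk)).1.2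
        (hortonPoint_mem (hWm k hk)).2.2) hαr hαI
  have hβα : α.Nonempty → β ∈ betweenFamily (fun _ _ _ => False) q := fun ⟨k, hk⟩ =>
    hI.mem_betweenFamily_false hbS (hαI k hk) (fun _ _ _ => area_lower_chain)
      (fun _ _ h => area_lower_lower h (hupper k).1 (hupper k).2) hβr hβI
  have hβW : W.Nonempty → β ∈ betweenFamily (fun _ _ _ => False) q := fun ⟨k, hk⟩ =>
    hI.mem_betweenFamily_false hbS (hWI k hk) (fun _ _ _ => area_lower_chain)
      (fun _ _ h => area_lower_lower h (hortonPoint_mem (hWm k hk)).1.1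
        (hortonPoint_mem (hWm k hk)).2.1) hβr hβI
  have hscale : (0 : ℝ) < 1 / (64 * ((m : ℝ) + 1) ^ 2) := by positivity
  have hWα : α.Nonempty → W ∈ hortonCups (1 / ((m : ℝ) + 4)) m := fun ⟨k, hk⟩ => by
    refine mem_betweenFamily.2 ⟨hWr, fun u hu v hv r hur hrv => ?_⟩
    by_contra hcon
    have hv' := hWm v hv
    refine hI _ (hWI u hu) _ (hWI v hv) _ (hαI k hk) _ (hzS r (by omega))
      (mem_interior_triangle_of_visible ?_ (area_horton_horton_upper hur (by omega))
        (area_horton_horton_upper hrv hv'))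
    rw [area_hortonPoint]
    exact mul_pos hscale (not_le.1 hcon)
  have hWβ : β.Nonempty → W ∈ hortonCaps (1 / ((m : ℝ) + 4)) m := fun ⟨k, hk⟩ => by
    refine mem_betweenFamily.2 ⟨hWr, fun u hu v hv r hur hrv => ?_⟩
    by_contra hcon
    have hv' := hWm v hv
    refine hI _ (hWI u hu) _ (hWI v hv) _ (hβI k hk) _ (hzS r (by omega))
      (mem_interior_triangle_of_visible' ?_ (area_horton_horton_lower hur (by omega))
        (area_horton_horton_lower hrv hv'))
    rw [area_hortonPoint]
    exact mul_neg_of_pos_of_neg hscale (not_le.1 hcon)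
  -- Seen from both sides, a pair in `W` has no Horton point between it above or below its segment,
  -- and none on it by general position; so none at all.
  have hWαβ : α.Nonempty → β.Nonempty → W ∈ betweenFamily (fun _ _ _ => False) m := by
    intro h1 h2
    refine mem_betweenFamily.2 ⟨hWr, fun u hu v hv r hur hrv => ?_⟩
    have g1 := (mem_betweenFamily.1 (hWα h1)).2 u hu v hv r hur hrv
    have g2 := (mem_betweenFamily.1 (hWβ h2)).2 u hu v hv r hur hrv
    have g3 := hortonArea_ne_zero (horton_scale m).1 (horton_scale m).2 hur hrv (hWm v hv)
    have g4 : hortonArea (1 / ((m : ℝ) + 4)) u r v = -hortonArea (1 / ((m : ℝ) + 4)) u v r := by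
      unfold hortonArea; ring
    exact g3 (by rw [g4, le_antisymm g1 g2, neg_zero])
  have hWhole : W ∈ hortonHoles (1 / ((m : ℝ) + 4)) m := by
    refine mem_hortonHoles.2 ⟨hWr, fun u hu v hv w hw r hr ⟨x, y, z⟩ => ?_⟩
    refine hI _ (hWI u hu) _ (hWI v hv) _ (hWI w hw) _ (hzS r hr) (mem_interior_triangle ?_ ?_ ?_)
    all_goals rw [area_hortonPoint]; exact mul_pos hscale (by assumption)
  refine ⟨(α, β, W), ?_, ?_⟩
  · simp only [holeIndices, Finset.mem_union, Finset.mem_product, Finset.mem_singleton,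
      Finset.mem_powerset]
    rcases α.eq_empty_or_nonempty with h1 | h1
    · rcases β.eq_empty_or_nonempty with h2 | h2
      · exact Or.inl (Or.inr ⟨h1, h2, hWhole⟩)
      · rcases W.eq_empty_or_nonempty with h3 | h3
        · exact Or.inl (Or.inl (Or.inr ⟨h1, hβr, h3⟩))
        · exact Or.inr (Or.inr ⟨h1, hβW h3, hWβ h2⟩)
    · rcases β.eq_empty_or_nonempty with h2 | h2
      · rcases W.eq_empty_or_nonempty with h3 | h3
        · exact Or.inl (Or.inl (Or.inl ⟨hαr, h2, h3⟩))
        · exact Or.inr (Or.inl (Or.inr ⟨hαW h3, h2, hWα h1⟩))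
      · exact Or.inr (Or.inl (Or.inl ⟨hαβ h2, hβα h1, hWαβ h1 h2⟩))
  · ext x
    simp only [pointsOfIndices, Finset.mem_union, Finset.mem_image]
    constructor
    · intro hx
      rcases mem_pointSet.1 (hIS hx) with ⟨t, ht, rfl⟩ | ⟨i, hi, rfl⟩
      · rcases mem_hyperbolaParams.1 ht with ⟨i, hi, rfl⟩ | ⟨i, hi, rfl⟩
        · exact Or.inl ⟨i, Finset.mem_filter.2 ⟨Finset.mem_range.2 hi, hx⟩, rfl⟩
        · exact Or.inr (Or.inl ⟨i, Finset.mem_filter.2 ⟨Finset.mem_range.2 hi, hx⟩, rfl⟩)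
      · exact Or.inr (Or.inr ⟨i, Finset.mem_filter.2 ⟨Finset.mem_range.2 hi, hx⟩, rfl⟩)
    · rintro (⟨i, hi, rfl⟩ | ⟨i, hi, rfl⟩ | ⟨i, hi, rfl⟩)
      · exact hαI i hi
      · exact hβI i hi
      · exact hWI i hi

theorem ncard_affineHoles_pointSet (p q m : ℕ) :
    (affineHoles (pointSet p q m)).ncard ≤ 2 ^ p + 2 ^ q + (13 * m ^ 2 + 1) +
      ((2 * p + 1) * ((2 * q + 1) * (2 * m + 1)) + (2 * p + 1) * (4 * m + 1) +
        (2 * q + 1) * (4 * m + 1)) := by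
  classical
  have hsub : affineHoles (pointSet p q m) ⊆
      ((holeIndices p q m).image fun x =>
        convexHull ℝ (pointsOfIndices m x : Set Plane) : Finset (Set Plane)) := by
    rintro H ⟨k, -, hH⟩
    obtain ⟨I, hIS, rfl, hI⟩ := hH.exists_trianglesEmpty
    obtain ⟨x, hx, rfl⟩ := hI.exists_indices hIS
    exact Finset.mem_coe.2 (Finset.mem_image.2 ⟨x, hx, rfl⟩)
  refine (Set.ncard_le_ncard hsub (Finset.finite_toSet _)).trans ?_
  rw [Set.ncard_coe_finset]
  exact Finset.card_image_le.trans (card_holeIndices p q m)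

/-! ### Projective convex hulls -/

open scoped NNReal

/-- The image in the projective plane of the convex cone spanned by `V`. -/
def projHull (V : Set (Fin 3 → ℝ)) : Set RP2 :=
  {x | ∃ (w : Fin 3 → ℝ) (hw : w ≠ 0), w ∈ Submodule.span ℝ≥0 V ∧ x = Projectivization.mk ℝ w hw}

theorem nonneg_of_mem_span {V : Set (Fin 3 → ℝ)} {f : (Fin 3 → ℝ) →ₗ[ℝ] ℝ}
    (hf : ∀ v ∈ V, 0 ≤ f v) {w : Fin 3 → ℝ} (hw : w ∈ Submodule.span ℝ≥0 V) : 0 ≤ f w := by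
  induction hw using Submodule.span_induction with
  | mem v hv => exact hf v hv
  | zero => simp
  | add v w _ _ h1 h2 => rw [map_add]; exact add_nonneg h1 h2
  | smul a v _ h => rw [NNReal.smul_def, map_smul]; exact mul_nonneg a.2 h

theorem pos_of_mem_span {V : Set (Fin 3 → ℝ)} {f : (Fin 3 → ℝ) →ₗ[ℝ] ℝ}
    (hf : ∀ v ∈ V, 0 < f v) {w : Fin 3 → ℝ} (hw : w ∈ Submodule.span ℝ≥0 V) (hw0 : w ≠ 0) :
    0 < f w := by
  have key : w = 0 ∨ 0 < f w := by
    clear hw0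
    induction hw using Submodule.span_induction with
    | mem v hv => exact Or.inr (hf v hv)
    | zero => exact Or.inl rfl
    | add v w _ _ h1 h2 =>
      rcases h1 with rfl | h1
      · simpa using h2
      · rcases h2 with rfl | h2
        · simpa using Or.inr h1
        · exact Or.inr (by rw [map_add]; exact add_pos h1 h2)
    | smul a v _ h =>
      rcases h with rfl | h
      · exact Or.inl (smul_zero a)
      · rcases eq_or_ne a 0 with rfl | ha
        · exact Or.inl (zero_smul _ v)
        · refine Or.inr ?_
          rw [NNReal.smul_def, map_smul]
          exact mul_pos (by positivity) h
  exact key.resolve_left hw0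

theorem apply_rep_ne_zero_iff (f : (Fin 3 → ℝ) →ₗ[ℝ] ℝ) {w : Fin 3 → ℝ} (hw : w ≠ 0) :
    f (Projectivization.mk ℝ w hw).rep ≠ 0 ↔ f w ≠ 0 := by
  obtain ⟨a, ha⟩ := Projectivization.exists_smul_eq_mk_rep ℝ w hw
  rw [← ha, Units.smul_def, map_smul, smul_eq_mul]
  simp

theorem mk_smul_eq {c : ℝ} {w : Fin 3 → ℝ} (hw : w ≠ 0) (h : c • w ≠ 0) :
    Projectivization.mk ℝ (c • w) h = Projectivization.mk ℝ w hw :=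
  (Projectivization.mk_eq_mk_iff' ℝ _ _ _ _).2 ⟨c, rfl⟩

theorem isProjConvex_projHull {V : Set (Fin 3 → ℝ)} {f : (Fin 3 → ℝ) →ₗ[ℝ] ℝ} (hf0 : f ≠ 0)
    (hf : ∀ v ∈ V, 0 < f v) : IsProjConvex (projHull V) := by
  refine ⟨?_, {p | f p.rep = 0}, ⟨f, hf0, rfl⟩, ?_⟩
  · rintro _ ⟨u, hu, hu', rfl⟩ _ ⟨v, hv, hv', rfl⟩
    refine ⟨u, v, hu, hv, rfl, rfl, ?_⟩
    rintro _ ⟨s, t, hs, ht, h, rfl⟩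
    exact ⟨_, h, add_mem (Submodule.smul_mem _ (⟨s, hs⟩ : ℝ≥0) hu')
      (Submodule.smul_mem _ (⟨t, ht⟩ : ℝ≥0) hv'), rfl⟩
  · rw [Set.disjoint_left]
    rintro _ ⟨u, hu, hu', rfl⟩
    exact (apply_rep_ne_zero_iff f hu).2 (pos_of_mem_span hf hu' hu).ne'

theorem mk_mem_projHull {V : Set (Fin 3 → ℝ)} {v : Fin 3 → ℝ} (hv : v ∈ V) (hv0 : v ≠ 0) :
    Projectivization.mk ℝ v hv0 ∈ projHull V :=
  ⟨v, hv0, Submodule.subset_span hv, rfl⟩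

/-- Of the two segments joining `[v]` and `[w]`, the one through `[v - c w]`, `c > 0`, meets the
line `f = 0`, which `X` avoids; so `X` contains the other, on which `[v + w]` lies. -/
theorem IsSemiconvex.mk_add_mem {X : Set RP2} (hX : IsSemiconvex X) {f : (Fin 3 → ℝ) →ₗ[ℝ] ℝ}
    (hXf : ∀ x ∈ X, f x.rep ≠ 0) {v w : Fin 3 → ℝ} (hv : 0 < f v) (hw : 0 < f w) (hv0 : v ≠ 0)
    (hw0 : w ≠ 0) (hvX : Projectivization.mk ℝ v hv0 ∈ X) (hwX : Projectivization.mk ℝ w hw0 ∈ X)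
    (h : v + w ≠ 0) : Projectivization.mk ℝ (v + w) h ∈ X := by
  obtain ⟨v', w', hv', hw', ev, ew, hseg⟩ := hX _ hvX _ hwX
  obtain ⟨c, rfl⟩ := (Projectivization.mk_eq_mk_iff' ℝ _ _ _ _).1 ev
  obtain ⟨d, rfl⟩ := (Projectivization.mk_eq_mk_iff' ℝ _ _ _ _).1 ew
  have hc : c ≠ 0 := fun h => hv' (by rw [h, zero_smul])
  have hd : d ≠ 0 := fun h => hw' (by rw [h, zero_smul])
  rcases lt_or_gt_of_ne (mul_ne_zero hc hd) with hcd | hcd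
  -- The wrong segment: these weights produce its vector with `f = 0`. That vector can vanish only
  -- if `v` and `w` are proportional, and then `[v + w] = [v]`.
  · have e1 : |d| * f w * c = -(|c| * f w * d) := by
      rcases lt_or_gt_of_ne hc with h1 | h1 <;> rcases lt_or_gt_of_ne hd with h2 | h2
      · nlinarith
      · rw [abs_of_neg h1, abs_of_pos h2]; ring
      · rw [abs_of_pos h1, abs_of_neg h2]; ring
      · nlinarith
    by_cases h0 : (|d| * f w) • c • v + (|c| * f v) • d • w = 0
    · have e2 : (|c| * d) • (f v • w - f w • v) = 0 := by
        rw [smul_sub]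
        simp only [smul_smul] at h0 ⊢
        rw [e1] at h0
        rw [← h0]
        module
      have e3 : f v • w - f w • v = 0 :=
        (smul_eq_zero.1 e2).resolve_left (mul_ne_zero (abs_ne_zero.2 hc) hd)
      have e4 : v + w = ((f v + f w) / f v) • v := by
        have : w = (f w / f v) • v := by
          rw [div_eq_inv_mul, mul_smul, ← sub_eq_zero.1 e3, smul_smul, inv_mul_cancel₀ hv.ne',
            one_smul]
        rw [add_div, div_self hv.ne', add_smul, one_smul, ← this]
      rw [(Projectivization.mk_eq_mk_iff' ℝ _ _ h hv0).2 ⟨_, e4.symm⟩]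
      exact hvX
    · have hmem := hseg ⟨|d| * f w, |c| * f v, by positivity, by positivity, h0, rfl⟩
      refine absurd ?_ ((apply_rep_ne_zero_iff f h0).1 (hXf _ hmem))
      simp only [map_add, map_smul, smul_eq_mul]
      linear_combination f v * e1
  · have h0 : |d| • c • v + |c| • d • w = (|d| * c) • (v + w) := by
      have : |c| * d = |d| * c := by
        rcases lt_or_gt_of_ne hc with h1 | h1 <;> rcases lt_or_gt_of_ne hd with h2 | h2
        · rw [abs_of_neg h1, abs_of_neg h2]; ring
        · nlinarith
        · nlinarith
        · rw [abs_of_pos h1, abs_of_pos h2]; ring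
      rw [smul_smul, smul_smul, this, smul_add]
    have h1 : (|d| * c) • (v + w) ≠ 0 := smul_ne_zero (mul_ne_zero (abs_ne_zero.2 hd) hc) h
    rw [← mk_smul_eq h h1]
    exact hseg ⟨|d|, |c|, abs_nonneg _, abs_nonneg _, h0 ▸ h1, by simp only [h0]⟩

/-- Once the avoided line is fixed, the hull is forced: the sign of each representative is dictated
by `f`, and the cone is generated by sums. -/
theorem projHull_subset {V : Set (Fin 3 → ℝ)} {f : (Fin 3 → ℝ) →ₗ[ℝ] ℝ} (hf : ∀ v ∈ V, 0 < f v)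
    {X : Set RP2} (hX : IsSemiconvex X) (hXf : ∀ x ∈ X, f x.rep ≠ 0)
    (hVX : ∀ v ∈ V, ∃ hv : v ≠ 0, Projectivization.mk ℝ v hv ∈ X) : projHull V ⊆ X := by
  rintro _ ⟨w, hw, hwV, rfl⟩
  have key : w = 0 ∨ 0 < f w ∧ ∃ hw : w ≠ 0, Projectivization.mk ℝ w hw ∈ X := by
    clear hw
    induction hwV using Submodule.span_induction with
    | mem v hv => exact Or.inr ⟨hf v hv, hVX v hv⟩
    | zero => exact Or.inl rfl
    | add v w _ _ h1 h2 =>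
      rcases h1 with rfl | ⟨h1, hv0, hv⟩
      · simpa using h2
      · rcases h2 with rfl | ⟨h2, hw0, hw⟩
        · simpa using Or.inr ⟨h1, hv0, hv⟩
        · have h3 : 0 < f (v + w) := by rw [map_add]; exact add_pos h1 h2
          have h4 : v + w ≠ 0 := fun h => by simp [h] at h3
          exact Or.inr ⟨h3, h4, hX.mk_add_mem hXf h1 h2 hv0 hw0 hv hw h4⟩
    | smul a v _ h =>
      rcases h with rfl | ⟨h, hv0, hv⟩
      · exact Or.inl (smul_zero a)
      · rcases eq_or_ne a 0 with rfl | ha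
        · exact Or.inl (zero_smul _ v)
        · refine Or.inr ?_
          rw [NNReal.smul_def, map_smul]
          have h0 : (a : ℝ) • v ≠ 0 := smul_ne_zero (by exact_mod_cast ha) hv0
          exact ⟨mul_pos (by positivity) h, h0, by rwa [mk_smul_eq hv0 h0]⟩
  obtain ⟨_, _, h⟩ := key.resolve_left hw
  exact h

/-- A finite set determines only finitely many projective holes. -/
theorem projHoles_finite {P : Set RP2} (hP : P.Finite) : (projHoles P).Finite := by
  set R : Set (Fin 3 → ℝ) := (fun x : RP2 => x.rep) '' P ∪ (fun x : RP2 => -x.rep) '' P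
  have hR : R.Finite := (hP.image _).union (hP.image _)
  refine (hR.finite_subsets.image projHull).subset ?_
  rintro H ⟨k, -, ⟨I, hIP, -, hmin, -⟩, -⟩
  obtain ⟨⟨⟨hsemi, L, ⟨f, hf0, rfl⟩, hdisj⟩, hIH⟩, hmin⟩ := hmin
  have hHf : ∀ x ∈ H, f x.rep ≠ 0 := fun x hx h => Set.disjoint_left.1 hdisj hx h
  -- A hole is determined by its points and by one sign for each representative, chosen so that `f`
  -- is positive.
  set V : Set (Fin 3 → ℝ) :=
    {v | v ∈ R ∧ 0 < f v ∧ ∃ hv : v ≠ 0, Projectivization.mk ℝ v hv ∈ (I : Set RP2)} with hV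
  refine ⟨V, fun v hv => hv.1, ?_⟩
  have h1 : projHull V ⊆ H := projHull_subset (f := f) (fun v hv => hv.2.1) hsemi hHf
    fun v hv => ⟨hv.2.2.1, hIH hv.2.2.2⟩
  refine h1.antisymm (hmin ⟨isProjConvex_projHull hf0 fun v hv => hv.2.1, ?_⟩ h1)
  intro x hx
  rcases lt_or_gt_of_ne (hHf x (hIH hx)) with h | h
  · have e : Projectivization.mk ℝ (-x.rep) (neg_ne_zero.2 x.rep_nonzero) = x := by
      conv_rhs => rw [← x.mk_rep]
      exact (Projectivization.mk_eq_mk_iff' ℝ _ _ _ _).2 ⟨-1, by simp⟩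
    have hv : -x.rep ∈ V := ⟨Or.inr ⟨x, hIP hx, rfl⟩, by rw [map_neg]; linarith,
      neg_ne_zero.2 x.rep_nonzero, by rwa [e]⟩
    have := mk_mem_projHull hv (neg_ne_zero.2 x.rep_nonzero)
    rwa [e] at this
  · have hv : x.rep ∈ V := ⟨Or.inl ⟨x, hIP hx, rfl⟩, h, x.rep_nonzero, by rwa [x.mk_rep]⟩
    have := mk_mem_projHull hv x.rep_nonzero
    rwa [x.mk_rep] at this

/-! ### Projective holes of the point set -/

/-- A vector representing the point of the hyperbola with abscissa `t`. -/
def conicVec (t : ℝ) : Fin 3 → ℝ := ![t ^ 2, 1, t]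

theorem conicVec_ne_zero (t : ℝ) : conicVec t ≠ 0 := fun h => one_ne_zero (congrFun h 1)

theorem embed_hyperbolaPoint {t : ℝ} (ht : t ≠ 0) :
    embed (hyperbolaPoint t) = Projectivization.mk ℝ (conicVec t) (conicVec_ne_zero t) := by
  refine (Projectivization.mk_eq_mk_iff' ℝ _ _ _ _).2 ⟨t⁻¹, ?_⟩
  ext i
  fin_cases i <;> simp [conicVec, hyperbolaPoint, ht]
  field_simp

/-- The linear form that vanishes to second order at `conicVec τ` along the conic. -/
def tangentForm (τ : ℝ) : (Fin 3 → ℝ) →ₗ[ℝ] ℝ :=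
  LinearMap.proj 0 - (2 * τ) • LinearMap.proj 2 + τ ^ 2 • LinearMap.proj 1

theorem tangentForm_apply (τ : ℝ) (w : Fin 3 → ℝ) :
    tangentForm τ w = w 0 - 2 * τ * w 2 + τ ^ 2 * w 1 := by
  simp [tangentForm]

theorem tangentForm_conicVec (τ t : ℝ) : tangentForm τ (conicVec t) = (t - τ) ^ 2 := by
  rw [tangentForm_apply]
  simp [conicVec]
  ring

theorem conic_coord_pos {T : Set ℝ} {w : Fin 3 → ℝ}
    (hw : w ∈ Submodule.span ℝ≥0 (conicVec '' T)) (hw0 : w ≠ 0) : 0 < w 1 :=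
  pos_of_mem_span (f := LinearMap.proj 1)
    (by rintro _ ⟨t, -, rfl⟩; simp [conicVec]) hw hw0

/-- The hull lies inside the conic: `tangentForm τ` is nonnegative on it, and `τ = w 2 / w 1` makes
the inequality exactly the quadratic one. -/
theorem conic_form_of_mk_mem {T : Set ℝ} {w : Fin 3 → ℝ} (hw : w ≠ 0)
    (h : Projectivization.mk ℝ w hw ∈ projHull (conicVec '' T)) : w 2 ^ 2 ≤ w 0 * w 1 := by
  obtain ⟨u, hu0, hu, e⟩ := h
  obtain ⟨c, rfl⟩ := (Projectivization.mk_eq_mk_iff' ℝ _ _ _ _).1 e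
  have h1 := conic_coord_pos hu hu0
  have h2 := nonneg_of_mem_span (f := tangentForm (u 2 / u 1))
    (by rintro _ ⟨t, -, rfl⟩; rw [tangentForm_conicVec]; positivity) hu
  rw [tangentForm_apply] at h2
  have h3 : (u 0 - 2 * (u 2 / u 1) * u 2 + (u 2 / u 1) ^ 2 * u 1) * u 1 =
      u 0 * u 1 - u 2 ^ 2 := by
    field_simp; ring
  have h4 := mul_nonneg h2 h1.le
  rw [h3] at h4
  simp only [Pi.smul_apply, smul_eq_mul]
  nlinarith [mul_nonneg (sq_nonneg c) h4]

/-- The tangent at `t` touches the conic only there, so a hull spanned by other conic points misses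
it. Consequently distinct `T` have distinct hulls. -/
theorem mk_conicVec_mem_iff {T : Set ℝ} {t : ℝ} :
    Projectivization.mk ℝ (conicVec t) (conicVec_ne_zero t) ∈ projHull (conicVec '' T) ↔
      t ∈ T := by
  refine ⟨fun h => ?_, fun h => mk_mem_projHull (Set.mem_image_of_mem _ h) _⟩
  by_contra ht
  obtain ⟨u, hu0, hu, e⟩ := h
  obtain ⟨c, hc⟩ := (Projectivization.mk_eq_mk_iff' ℝ _ _ _ _).1 e
  have h1 := pos_of_mem_span (f := tangentForm t) (by
    rintro _ ⟨s, hs, rfl⟩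
    rw [tangentForm_conicVec]
    have : s - t ≠ 0 := sub_ne_zero.2 fun h => ht (h ▸ hs)
    positivity) hu hu0
  have h2 := congrArg (tangentForm t) hc
  rw [map_smul, tangentForm_conicVec, sub_self, smul_eq_mul, zero_pow two_ne_zero] at h2
  have hc0 : c ≠ 0 := fun h => conicVec_ne_zero t (by rw [← hc, h, zero_smul])
  exact (mul_ne_zero hc0 h1.ne') h2

theorem mk_conicVec_notMem_interior (T : Set ℝ) (t : ℝ) :
    Projectivization.mk ℝ (conicVec t) (conicVec_ne_zero t) ∉
      interior (projHull (conicVec '' T)) := by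
  intro h
  have hne : ∀ e : ℝ, (![t ^ 2 - e, 1, t] : Fin 3 → ℝ) ≠ 0 := fun e h =>
    one_ne_zero (congrFun h 1)
  -- For `e > 0` this path from the conic point runs in the region `w 2 ^ 2 > w 0 * w 1`, outside
  -- every hull.
  set γ : ℝ → RP2 := fun e => Projectivization.mk' ℝ ⟨![t ^ 2 - e, 1, t], hne e⟩
  have hγ : Continuous γ := by
    refine Continuous.comp (continuous_coinduced_rng
      (f := (Projectivization.mk' ℝ : {v : Fin 3 → ℝ // v ≠ 0} → RP2))) ?_
    refine Continuous.subtype_mk ?_ _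
    refine continuous_pi fun i => ?_
    fin_cases i <;> simp <;> fun_prop
  have h0 : γ 0 = Projectivization.mk ℝ (conicVec t) (conicVec_ne_zero t) := by
    simp [γ, conicVec]
  have hnhds : γ ⁻¹' interior (projHull (conicVec '' T)) ∈ nhds (0 : ℝ) :=
    (isOpen_interior.preimage hγ).mem_nhds (by rw [Set.mem_preimage, h0]; exact h)
  obtain ⟨r, hr, hball⟩ := Metric.mem_nhds_iff.1 hnhds
  have hmem : γ (r / 2) ∈ projHull (conicVec '' T) := interior_subset (hball (by
    rw [Metric.mem_ball, Real.dist_eq, sub_zero, abs_of_pos (by positivity)]; linarith))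
  have := conic_form_of_mk_mem (hne (r / 2)) hmem
  simp at this
  linarith

/-- A convex competitor inside `projHull V` avoids the same line `f = 0`, so it must contain the
whole cone. -/
theorem isProjConvexHull_projHull {V : Set (Fin 3 → ℝ)} {f : (Fin 3 → ℝ) →ₗ[ℝ] ℝ} (hf0 : f ≠ 0)
    (hf : ∀ v ∈ V, 0 < f v) {Y : Set RP2} (hY : Y ⊆ projHull V)
    (hVY : ∀ v ∈ V, ∃ hv : v ≠ 0, Projectivization.mk ℝ v hv ∈ Y) :
    IsProjConvexHull Y (projHull V) := by
  refine ⟨⟨isProjConvex_projHull hf0 hf, hY⟩, ?_⟩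
  rintro X ⟨⟨hX, -⟩, hYX⟩ hXV
  refine projHull_subset hf hX ?_ fun v hv => ⟨(hVY v hv).1, hYX (hVY v hv).2⟩
  intro x hx
  obtain ⟨w, hw, hwV, rfl⟩ := hXV hx
  exact (apply_rep_ne_zero_iff f hw).2 (pos_of_mem_span hf hwV hw).ne'

theorem embed_notMem_projHull_conic {T : Set ℝ} {x : Plane} (hx : x 0 * x 1 < 1) :
    embed x ∉ projHull (conicVec '' T) := by
  intro h
  have := conic_form_of_mk_mem _ h
  simp at this
  linarith

theorem projHull_conic_mem_projHoles {p q m : ℕ} {T : Finset ℝ} (hT : T ⊆ hyperbolaParams p q)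
    (hcard : 3 ≤ T.card) :
    projHull (conicVec '' T) ∈ projHoles (embed '' (pointSet p q m : Set Plane)) := by
  classical
  have hT0 : ∀ t ∈ T, t ≠ 0 := fun t ht => ne_zero_of_mem_hyperbolaParams (hT ht)
  have hinj : Set.InjOn (fun t => embed (hyperbolaPoint t)) T := by
    intro s hs t ht h
    simp only [embed_hyperbolaPoint (hT0 s hs), embed_hyperbolaPoint (hT0 t ht)] at h
    have h1 : Projectivization.mk ℝ (conicVec s) (conicVec_ne_zero s) ∈
        projHull (conicVec '' {t}) := by
      rw [h]; exact mk_conicVec_mem_iff.2 rfl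
    exact (mk_conicVec_mem_iff (T := {t})).1 h1
  have hsub : ((T.image fun t => embed (hyperbolaPoint t) : Finset RP2) : Set RP2) ⊆
      projHull (conicVec '' T) := by
    intro x hx
    obtain ⟨t, ht, rfl⟩ := Finset.mem_image.1 (Finset.mem_coe.1 hx)
    rw [embed_hyperbolaPoint (hT0 t ht)]
    exact mk_conicVec_mem_iff.2 ht
  refine ⟨T.card, hcard, ⟨T.image fun t => embed (hyperbolaPoint t), ?_,
    Finset.card_image_of_injOn hinj, ?_, ?_⟩, ?_⟩
  · intro x hx
    obtain ⟨t, ht, rfl⟩ := Finset.mem_image.1 (Finset.mem_coe.1 hx)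
    exact ⟨_, mem_pointSet.2 (Or.inl ⟨t, hT ht, rfl⟩), rfl⟩
  -- The avoided line is the asymptote `y = 0`, tangent to the hyperbola at infinity; all `conicVec
  -- t` lie on its positive side.
  · refine isProjConvexHull_projHull (f := LinearMap.proj 1) ?_ ?_ hsub ?_
    · intro h
      have := LinearMap.congr_fun h (fun _ => 1)
      simp at this
    · rintro _ ⟨t, -, rfl⟩
      simp [conicVec]
    · rintro _ ⟨t, ht, rfl⟩
      refine ⟨conicVec_ne_zero t, ?_⟩
      rw [← embed_hyperbolaPoint (hT0 t ht)]
      exact Finset.mem_coe.2 (Finset.mem_image.2 ⟨t, ht, rfl⟩)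
  · intro x hx
    refine ⟨subset_closure (hsub hx), ?_⟩
    obtain ⟨t, ht, rfl⟩ := Finset.mem_image.1 (Finset.mem_coe.1 hx)
    rw [embed_hyperbolaPoint (hT0 t ht)]
    exact mk_conicVec_notMem_interior _ t
  · rw [Set.disjoint_right]
    rintro _ ⟨x, hx, rfl⟩
    rcases mem_pointSet.1 hx with ⟨t, ht, rfl⟩ | ⟨i, hi, rfl⟩
    · rw [embed_hyperbolaPoint (ne_zero_of_mem_hyperbolaParams ht)]
      exact mk_conicVec_notMem_interior _ t
    · exact fun h => embed_notMem_projHull_conic (hortonPoint_mul_lt hi) (interior_subset h)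

theorem two_pow_le_ncard_projHoles {p q : ℕ} (m : ℕ) (hpq : 3 ≤ p + q) :
    2 ^ (p + q - 3) ≤ (projHoles (embed '' (pointSet p q m : Set Plane))).ncard := by
  -- Only supersets of a fixed triple are counted, which guarantees at least three vertices at the
  -- cost of a factor 8.
  obtain ⟨T₀, hT₀, hcard⟩ := Finset.exists_subset_card_eq
    (s := hyperbolaParams p q) (n := 3) (by rwa [card_hyperbolaParams])
  have hinj : Function.Injective fun T : Finset ℝ => projHull (conicVec '' (T : Set ℝ)) := by
    intro S T h
    ext t
    simp only at h
    rw [← Finset.mem_coe, ← Finset.mem_coe, ← mk_conicVec_mem_iff, h, mk_conicVec_mem_iff]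
  have hsub : (fun T : Finset ℝ => projHull (conicVec '' (T : Set ℝ))) ''
      (Finset.Icc T₀ (hyperbolaParams p q) : Set (Finset ℝ)) ⊆
      projHoles (embed '' (pointSet p q m : Set Plane)) := by
    rintro _ ⟨T, hT, rfl⟩
    obtain ⟨h1, h2⟩ := Finset.mem_Icc.1 (Finset.mem_coe.1 hT)
    exact projHull_conic_mem_projHoles h2 (hcard ▸ Finset.card_le_card h1)
  -- Finiteness matters: `ncard` of an infinite set is 0.
  have h := Set.ncard_le_ncard hsub (projHoles_finite ((Finset.finite_toSet _).image _))
  rwa [Set.ncard_image_of_injective _ hinj, Set.ncard_coe_finset,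
    Finset.card_Icc_finset hT₀, card_hyperbolaParams, hcard] at h

/-! ### Choice of the parameters -/

/-- The quotient `k ^ 4 / 2 ^ k` peaks at `k = 6` with value `81 / 4`. -/
theorem pow_four_le_two_pow (k : ℕ) : k ^ 4 ≤ 21 * 2 ^ k := by
  rcases Nat.lt_or_ge k 6 with h | h
  · interval_cases k <;> norm_num
  · induction k, h using Nat.le_induction with
    | base => norm_num
    | succ k hk ih =>
      have h2 : (k + 1) ^ 4 ≤ 2 * k ^ 4 := by
        have h3 : 36 * k ^ 2 ≤ k ^ 4 := by
          rw [show k ^ 4 = k ^ 2 * k ^ 2 by ring]; gcongr; nlinarith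
        have h4 : 6 * k ^ 3 ≤ k ^ 4 := by
          rw [show k ^ 4 = k * k ^ 3 by ring]; gcongr
        have h5 : k ≤ k ^ 2 := by nlinarith
        have h6 : 1 ≤ k ^ 2 := by nlinarith
        have h7 : (k + 1) ^ 4 = k ^ 4 + 4 * k ^ 3 + 6 * k ^ 2 + 4 * k + 1 := by ring
        omega
      calc (k + 1) ^ 4 ≤ 2 * k ^ 4 := h2
        _ ≤ 2 * (21 * 2 ^ k) := by gcongr
        _ = 21 * 2 ^ (k + 1) := by ring

theorem balanced_count_le {n k x : ℕ} (hk : 2 ≤ k) (hkn : 2 * k ≤ n) (hx : 2 ^ k ≤ x) :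
    2 ^ k + 2 ^ k + (13 * (n - 2 * k) ^ 2 + 1) +
      ((2 * k + 1) * ((2 * k + 1) * (2 * (n - 2 * k) + 1)) +
        (2 * k + 1) * (4 * (n - 2 * k) + 1) + (2 * k + 1) * (4 * (n - 2 * k) + 1)) ≤
      600 * (x + n ^ 2) := by
  have hm : n - 2 * k ≤ n := Nat.sub_le _ _
  generalize n - 2 * k = m at hm
  have hn : 1 ≤ n := by omega
  have h1 : 13 * m ^ 2 + 1 ≤ 14 * n ^ 2 := by nlinarith
  have h2 : (2 * k + 1) * (4 * m + 1) ≤ (2 * n) * (5 * n) :=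
    Nat.mul_le_mul (by omega) (by omega)
  have h3 : (2 * k + 1) * ((2 * k + 1) * (2 * m + 1)) ≤ (3 * k) * ((3 * k) * (3 * n)) :=
    Nat.mul_le_mul (by omega) (Nat.mul_le_mul (by omega) (by omega))
  -- With `pow_four_le_two_pow` the total is at most `569 * 2 ^ k + 61 * n ^ 2`, whence the constant
  -- 600.
  have h4 : k ^ 2 * n ≤ n ^ 2 + k ^ 4 := by
    rcases le_total (k ^ 2) n with h | h
    · nlinarith [Nat.mul_le_mul_right n h]
    · nlinarith [Nat.mul_le_mul_left (k ^ 2) h]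
  have h5 := pow_four_le_two_pow k
  nlinarith

theorem small_count_le {n x : ℕ} (hn : 3 ≤ n) :
    2 ^ 3 + 2 ^ 0 + (13 * (n - 3) ^ 2 + 1) +
      ((2 * 3 + 1) * ((2 * 0 + 1) * (2 * (n - 3) + 1)) +
        (2 * 3 + 1) * (4 * (n - 3) + 1) + (2 * 0 + 1) * (4 * (n - 3) + 1)) ≤
      600 * (x + n ^ 2) := by
  have hm : n - 3 ≤ n := Nat.sub_le _ _
  generalize n - 3 = m at hm
  nlinarith

theorem two_mul_log_le {n x : ℕ} (hx : 1 ≤ x) (h : (x : ℝ) ≤ (2 : ℝ) ^ ((n : ℝ) / 2)) :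
    2 * Nat.log 2 x ≤ n := by
  have h1 : ((2 ^ Nat.log 2 x : ℕ) : ℝ) ≤ x := by
    exact_mod_cast Nat.pow_log_le_self 2 (by omega)
  have h2 : (2 : ℝ) ^ (Nat.log 2 x : ℝ) ≤ (2 : ℝ) ^ ((n : ℝ) / 2) := by
    rw [Real.rpow_natCast]
    push_cast at h1
    exact h1.trans h
  have h3 := (Real.rpow_le_rpow_left_iff (by norm_num : (1 : ℝ) < 2)).1 h2
  have h4 : (2 : ℝ) * Nat.log 2 x ≤ n := by linarith
  exact_mod_cast h4

end ProjHoles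

end

/-! ### Assembly -/

theorem mainTheorem6 :
    ∃ C c : ℝ, 0 < C ∧ 0 < c ∧
      ∀ n x : ℕ, 3 ≤ n → 1 ≤ x → (x : ℝ) ≤ (2 : ℝ) ^ ((n : ℝ) / 2) →
        ∃ S : Finset ProjHoles.Plane, S.card = n ∧
          ProjHoles.GeneralPosition (S : Set ProjHoles.Plane) ∧
          ((ProjHoles.affineHoles S).ncard : ℝ) ≤ C * ((x : ℝ) + (n : ℝ) ^ 2) ∧
          c * (x : ℝ) ^ 2 ≤
            ((ProjHoles.projHoles (ProjHoles.embed '' (S : Set ProjHoles.Plane))).ncard : ℝ) := by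
  refine ⟨600, 1 / 32, by norm_num, by norm_num, fun n x hn hx hxn => ?_⟩
  have hkn := ProjHoles.two_mul_log_le hx hxn
  have hlow : 2 ^ Nat.log 2 x ≤ x := Nat.pow_log_le_self 2 (by omega)
  have hup : x < 2 ^ (Nat.log 2 x + 1) := Nat.lt_pow_succ_log_self (by norm_num) x
  generalize Nat.log 2 x = k at hkn hlow hup
  rcases Nat.lt_or_ge k 2 with hk | hk
  -- For `x < 4` one projective hole suffices, and three points on one branch provide it.
  · refine ⟨ProjHoles.pointSet 3 0 (n - 3), ?_, ProjHoles.generalPosition_pointSet _ _ _, ?_, ?_⟩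
    · rw [ProjHoles.card_pointSet]; omega
    · exact_mod_cast (ProjHoles.ncard_affineHoles_pointSet _ _ _).trans
        (ProjHoles.small_count_le hn)
    · have h1 : x < 2 ^ 2 := hup.trans_le (Nat.pow_le_pow_right (by norm_num) (by omega))
      have h2 : (x : ℝ) ≤ 4 := by exact_mod_cast h1.le
      have h3 : (1 : ℝ) ≤ ((ProjHoles.projHoles (ProjHoles.embed ''
          (ProjHoles.pointSet 3 0 (n - 3) : Set ProjHoles.Plane))).ncard : ℝ) := by
        exact_mod_cast ProjHoles.two_pow_le_ncard_projHoles (p := 3) (q := 0) (n - 3) le_rfl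
      have h4 : (0 : ℝ) ≤ x := x.cast_nonneg
      nlinarith
  · refine ⟨ProjHoles.pointSet k k (n - 2 * k), ?_, ProjHoles.generalPosition_pointSet _ _ _,
      ?_, ?_⟩
    · rw [ProjHoles.card_pointSet]; omega
    · exact_mod_cast (ProjHoles.ncard_affineHoles_pointSet _ _ _).trans
        (ProjHoles.balanced_count_le hk hkn hlow)
    · have h1 := ProjHoles.two_pow_le_ncard_projHoles (p := k) (q := k) (n - 2 * k) (by omega)
      -- The factor 32 is `2 ^ 2` from rounding the logarithm down times `2 ^ 3` from the fixed
      -- triple.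
      have h2 : x ^ 2 ≤ 32 * 2 ^ (k + k - 3) := by
        calc x ^ 2 ≤ (2 ^ (k + 1)) ^ 2 := Nat.pow_le_pow_left hup.le 2
          _ = 2 ^ (5 + (k + k - 3)) := by rw [← pow_mul]; congr 1; omega
          _ = 32 * 2 ^ (k + k - 3) := by rw [pow_add]; norm_num
      have h3 : (x : ℝ) ^ 2 ≤ 32 * ((ProjHoles.projHoles (ProjHoles.embed ''
          (ProjHoles.pointSet k k (n - 2 * k) : Set ProjHoles.Plane))).ncard : ℝ) := by
        exact_mod_cast h2.trans (Nat.mul_le_mul_left 32 h1)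
      linarith
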